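/- Let $\mathbb T=\mathbb R/2\pi\mathbb Z$. For $f\in C(\mathbb T^2)$ (complex-valued) with Fourier coefficients $c_{nm}=\frac1{4\pi^2}\int_{\mathbb T^2}f(x,y)e^{-i(nx+my)}\,dx\,dy$, and a bounded region $G\subset\mathbb R^2$, put $$S_G(x,y,f)=\sum_{(n,m)\in G\cap\mathbb Z^2}c_{nm}e^{i(nx+my)}.$$ For an open ball (disc) $U\subset\mathbb R^2$ with center $(x_0,y_0)$ and radius $r>0$, put $\tau(U)=\sqrt{x_0^2+y_0^2}/r$. Then there exist a continuous function $f\in C(\mathbb T^2)$ and a sequence of open balls $U_k\subset\mathbb R^2$, $k=1,2,\ldots$, that is complete, i.e. $\bigcup_{k=1}^\infty U_k=\mathbb R^2$, such that $\tau(U_k)\to0$ as $k\to\infty$ and $$\limsup_{k\to\infty}|S_{U_k}(x,y,f)|=\infty\quad\text{for almost every }(x,y)\in\mathbb T^2.$$ -/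

import Mathlib

open MeasureTheory Filter Topology

noncomputable section

namespace DoubleFourier

instance factTwoPiPos : Fact (0 < 2 * Real.pi) := ⟨Real.two_pi_pos⟩

/-- The two-dimensional torus `𝕋² = (ℝ/2πℤ)²`. -/
abbrev Torus2 : Type := AddCircle (2 * Real.pi) × AddCircle (2 * Real.pi)

/-- The frequency plane `ℝ²` with its Euclidean metric. -/
abbrev Plane : Type := EuclideanSpace ℝ (Fin 2)

/-- The character `(x, y) ↦ e^{i(nx+my)}` of the torus. -/
def character (n m : ℤ) (z : Torus2) : ℂ := fourier n z.1 * fourier m z.2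

theorem character_coe (n m : ℤ) (x y : ℝ) :
    character n m ((x : AddCircle (2 * Real.pi)), (y : AddCircle (2 * Real.pi))) =
      Complex.exp (Complex.I * (n * x + m * y)) := by
  have hpi : (Real.pi : ℂ) ≠ 0 := Complex.ofReal_ne_zero.mpr Real.pi_ne_zero
  simp only [character, fourier_coe_apply, ← Complex.exp_add]
  congr 1
  push_cast
  field_simp

/-- The Fourier coefficient
`c_{nm} = (1 / 4π²) ∫_{𝕋²} f(x, y) e^{-i(nx+my)} dx dy`, where `𝕋²` has total mass `4π²`. -/
def coeff (f : Torus2 → ℂ) (n m : ℤ) : ℂ :=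
  (1 / (4 * (Real.pi : ℂ) ^ 2)) * ∫ z : Torus2, f z * character (-n) (-m) z

/-- The integer points `(n, m)` lying in a region of the plane. -/
def latticePoints (G : Set Plane) : Set (ℤ × ℤ) := {p | !₂[(p.1 : ℝ), (p.2 : ℝ)] ∈ G}

/-- A bounded region contains only finitely many integer points, so that the sum in
`partialSum` is a genuine finite sum for such regions. -/
theorem latticePoints_finite {G : Set Plane} (hG : Bornology.IsBounded G) :
    (latticePoints G).Finite := by
  obtain ⟨R, hR⟩ := hG.exists_norm_le
  refine ((Set.finite_Icc (-⌈R⌉) ⌈R⌉).prod (Set.finite_Icc (-⌈R⌉) ⌈R⌉)).subset ?_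
  rintro ⟨n, m⟩ h
  have h1 := hR _ h
  have key : ∀ k : ℤ, |(k : ℝ)| ≤ R → k ∈ Set.Icc (-⌈R⌉) ⌈R⌉ := by
    intro k hk
    have hk2 : |k| ≤ ⌈R⌉ := by
      have : ((|k| : ℤ) : ℝ) ≤ (⌈R⌉ : ℝ) := by
        push_cast
        exact hk.trans (Int.le_ceil R)
      exact_mod_cast this
    exact abs_le.mp hk2
  have a := (PiLp.norm_apply_le (!₂[(n : ℝ), (m : ℝ)] : Plane) 0).trans h1
  have b := (PiLp.norm_apply_le (!₂[(n : ℝ), (m : ℝ)] : Plane) 1).trans h1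
  exact ⟨key n (by simpa using a), key m (by simpa using b)⟩

/-- The partial sum `S_G(x, y, f) = ∑_{(n,m) ∈ G} c_{nm} e^{i(nx+my)}` of the double Fourier
series of `f` over a bounded region `G`. -/
def partialSum (G : Set Plane) (z : Torus2) (f : Torus2 → ℂ) : ℂ :=
  ∑ᶠ p ∈ latticePoints G, coeff f p.1 p.2 * character p.1 p.2 z

/-- A sequence of regions is complete if its union is the whole plane. -/
def IsCompleteSeq (G : ℕ → Set Plane) : Prop := ⋃ k, G k = Set.univ

/-- The eccentricity with respect to the origin of the ball with centre `c` and radius `r`. -/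
def eccentricity (c : Plane) (r : ℝ) : ℝ := ‖c‖ / r

end DoubleFourier

end

/-! A bounded trigonometric polynomial can have huge partial sums over half-planes, provided the
slope of the boundary line may depend on the point. Such polynomials come from a random-walk
construction. Multiplying `1 + F` by `1 + i a cos y` increases the sup of its squared modulus by a
factor of at most `1 + a²`, because the perturbation is imaginary. A half-plane keeps only one of
the two frequencies of the cosine, and the surviving term `(i a / 2) e^{± i y}` has real part `∓ (a
/ 2) sin y`. If the sign can be chosen to be that of `sin y`, every step pushes the real part down
by about `(a / 2) |sin y|`, which is of first order in `a`.

To make the choice available at every step, `F` is replaced by a mixture of two sheared dilates,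
with a polynomial approximation `q` of the indicator of `sin y > 0` as weight. The two shears send
the slopes in `(-1, 1)` to positive and to negative slopes respectively, so a slope encodes the
whole sequence of signs and finitely many slopes suffice. A large dilation `m` makes the new factor
nearly independent of the old polynomial and keeps frequencies from crossing the boundary line.

After `n = N²` steps with `a = κ / N` the polynomial is bounded, the mean of the selected partial
sums has size `N κ`, and their variance is at most a multiple of `κ²` times the squared mean.
Chebyshev's inequality gives `exists_bounded_large_halfPlane_sums`; the induction is
`exists_isBlock_succ`.

Half-planes become balls by moving the spectrum to a distant point `(l, 0)`: a circle through this
point, of radius comparable to `l`, looks there like its tangent line. Compressing the slopes by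
stretching the second frequency brings the centre close to the origin relative to the radius
(`exists_bounded_large_ball_sums`). Finally the sum of `2⁻ᵏ P k`, with spectra in disjoint annuli,
is continuous, and Borel–Cantelli gives divergence almost everywhere. -/

noncomputable section

namespace DoubleFourier

/-! ### Haar measure and orthogonality of characters. -/

/-- The normalised Haar measure on the torus. -/
def torusHaar : Measure Torus2 :=
  (AddCircle.haarAddCircle : Measure (AddCircle (2 * Real.pi))).prod AddCircle.haarAddCircle

instance torusHaar_isProbabilityMeasure : IsProbabilityMeasure torusHaar := by
  unfold torusHaar; infer_instance

instance torusHaar_isAddHaarMeasure : torusHaar.IsAddHaarMeasure := by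
  unfold torusHaar; infer_instance

theorem volume_eq_smul_torusHaar :
    (volume : Measure Torus2) = ENNReal.ofReal (4 * Real.pi ^ 2) • torusHaar := by
  rw [Measure.volume_eq_prod, AddCircle.volume_eq_smul_haarAddCircle, Measure.prod_smul_left,
    Measure.prod_smul_right, smul_smul, torusHaar, ← ENNReal.ofReal_mul Real.two_pi_pos.le]
  congr 2
  ring

theorem coeff_eq_integral (f : Torus2 → ℂ) (n m : ℤ) :
    coeff f n m = ∫ z, f z * character (-n) (-m) z ∂torusHaar := by
  have hpi : (Real.pi : ℂ) ≠ 0 := Complex.ofReal_ne_zero.mpr Real.pi_ne_zero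
  rw [coeff, volume_eq_smul_torusHaar, integral_smul_measure, ENNReal.toReal_ofReal (by positivity),
    Complex.real_smul]
  push_cast
  field_simp

theorem continuous_character (n m : ℤ) : Continuous (character n m) := by
  unfold character; fun_prop

theorem norm_character (n m : ℤ) (z : Torus2) : ‖character n m z‖ = 1 := by
  rw [character, norm_mul, fourier_apply, fourier_apply, Circle.norm_coe, Circle.norm_coe, one_mul]

theorem character_add (n m n' m' : ℤ) (z : Torus2) :
    character (n + n') (m + m') z = character n m z * character n' m' z := by
  simp only [character, fourier_add]; ring

@[simp] theorem character_zero (z : Torus2) : character 0 0 z = 1 := by simp [character]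

theorem exists_fourier_ne_one {j : ℤ} (hj : j ≠ 0) :
    ∃ t : AddCircle (2 * Real.pi), fourier j t ≠ 1 := by
  refine ⟨((2 * Real.pi / 2 / j : ℝ) : AddCircle (2 * Real.pi)), fun h => ?_⟩
  have h2 := fourier_add_half_inv_index hj Real.two_pi_pos (0 : AddCircle (2 * Real.pi))
  rw [zero_add] at h2
  rw [h2] at h
  simp at h
  norm_num at h

theorem integral_character_of_ne {n m : ℤ} (h : (n, m) ≠ 0) :
    ∫ z, character n m z ∂torusHaar = 0 := by
  obtain ⟨t, ht⟩ : ∃ t : Torus2, character n m t ≠ 1 := by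
    by_cases hn : n = 0
    · have hm : m ≠ 0 := by rintro rfl; exact h (by simp [hn])
      obtain ⟨t, ht⟩ := exists_fourier_ne_one hm
      exact ⟨(0, t), by simpa [character] using ht⟩
    · obtain ⟨t, ht⟩ := exists_fourier_ne_one hn
      exact ⟨(t, 0), by simpa [character] using ht⟩
  have h1 : ∀ z, character n m (z + t) = character n m t * character n m z := by
    intro z
    simp [character, fourier_apply, AddCircle.toCircle_add]
    ring
  have h2 := integral_add_right_eq_self (μ := torusHaar) (character n m) t
  simp_rw [h1, integral_const_mul] at h2
  by_contra h3
  exact ht (mul_right_cancel₀ h3 (h2.trans (one_mul _).symm))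

theorem integral_character (n m : ℤ) :
    ∫ z, character n m z ∂torusHaar = if (n, m) = 0 then 1 else 0 := by
  split_ifs with h
  · simp only [Prod.mk_eq_zero] at h
    simp [h]
  · exact integral_character_of_ne h

/-! ### Shears of the torus and their independence from low frequencies in `y`. -/

/-- The endomorphism `(x, y) ↦ (m x, m (2 y + s x))` of the torus. -/
def shear (s m : ℤ) : Torus2 →+ Torus2 where
  toFun z := (m • z.1, m • (2 • z.2 + s • z.1))
  map_zero' := by simp
  map_add' a b := by
    ext
    · simp only [Prod.fst_add, smul_add]
    · simp only [Prod.fst_add, Prod.snd_add, smul_add]; abel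

theorem shear_apply (s m : ℤ) (z : Torus2) :
    shear s m z = (m • z.1, m • (2 • z.2 + s • z.1)) := rfl

theorem continuous_shear (s m : ℤ) : Continuous (shear s m) := by
  change Continuous fun z : Torus2 => (m • z.1, m • (2 • z.2 + s • z.1))
  fun_prop

theorem exists_zsmul_eq {m : ℤ} (hm : m ≠ 0) (u : AddCircle (2 * Real.pi)) : ∃ x, m • x = u :=
  ⟨DivisibleBy.div u m, DivisibleBy.div_cancel u hm⟩

theorem measurePreserving_of_surjective {φ : Torus2 →+ Torus2} (hc : Continuous φ)
    (hs : Function.Surjective φ) : MeasurePreserving φ torusHaar torusHaar :=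
  AddMonoidHom.measurePreserving hc hs (by simp)

theorem measurePreserving_shear (s : ℤ) {m : ℤ} (hm : m ≠ 0) :
    MeasurePreserving (shear s m) torusHaar torusHaar := by
  refine measurePreserving_of_surjective (continuous_shear s m) ?_
  rintro ⟨u, v⟩
  obtain ⟨x, hx⟩ := exists_zsmul_eq hm u
  obtain ⟨w, hw⟩ := exists_zsmul_eq hm v
  obtain ⟨y, hy⟩ := exists_zsmul_eq (m := 2) two_ne_zero (w - s • x)
  refine ⟨(x, y), ?_⟩
  have hy' : (2 : ℕ) • y = w - s • x := by rw [← hy]; exact (natCast_zsmul y 2).symm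
  rw [shear_apply, hx, hy', sub_add_cancel, hw]

theorem character_shear (s m a b : ℤ) (z : Torus2) :
    character a b (shear s m z) = character (m * (a + s * b)) (m * (2 * b)) z := by
  obtain ⟨x, y⟩ := z
  induction x using QuotientAddGroup.induction_on with | _ x
  induction y using QuotientAddGroup.induction_on with | _ y
  have h : shear s m ((x : AddCircle (2 * Real.pi)), (y : AddCircle (2 * Real.pi))) =
      (((m * x : ℝ) : AddCircle (2 * Real.pi)),
        ((m * (2 * y + s * x) : ℝ) : AddCircle (2 * Real.pi))) := by
    have h1 : (m * x : ℝ) = m • x := by simp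
    have h2 : (m * (2 * y + s * x) : ℝ) = m • (2 • y + s • x) := by simp; ring
    rw [h1, h2]
    rfl
  rw [h]
  erw [character_coe, character_coe]
  congr 1
  push_cast
  ring

theorem integral_comp_shear (s : ℤ) {m : ℤ} (hm : m ≠ 0) (H : C(Torus2, ℂ)) :
    ∫ z, H (shear s m z) ∂torusHaar = ∫ z, H z ∂torusHaar := by
  have h := measurePreserving_shear s hm
  conv_rhs => rw [← h.map_eq]
  exact (integral_map h.measurable.aemeasurable H.continuous.aestronglyMeasurable).symm

/-- Translating `y` by `π / m` leaves `shear s m` unchanged, thanks to the factor 2 in its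
definition, but multiplies the character by `e^{i j π / m}`, which is not 1 when `0 < |j| < m`.
Invariance of the measure forces the integral to vanish. -/
theorem integral_fourier_mul_comp_shear {j : ℤ} (hj : j ≠ 0) (s : ℤ) {m : ℤ} (hm : |j| < m)
    (H : Torus2 → ℂ) : ∫ z, fourier j z.2 * H (shear s m z) ∂torusHaar = 0 := by
  have hm0 : (m : ℝ) ≠ 0 := by
    have := abs_nonneg j
    exact_mod_cast (by omega : m ≠ 0)
  let t : AddCircle (2 * Real.pi) := ((Real.pi / m : ℝ) : AddCircle (2 * Real.pi))
  have h0 : m • (2 • t) = 0 := by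
    have : m • (2 • t) = ((m • (2 • (Real.pi / m)) : ℝ) : AddCircle (2 * Real.pi)) := rfl
    rw [this, AddCircle.coe_eq_zero_iff]
    refine ⟨1, ?_⟩
    simp
    field_simp
  have h1 : ∀ z : Torus2, shear s m (z + (0, t)) = shear s m z := by
    intro z
    have : shear s m (0, t) = 0 := by
      rw [shear_apply]; ext <;> simp [h0]
    rw [map_add, this, add_zero]
  have h2 : fourier j t ≠ 1 := by
    simp only [t, fourier_coe_apply]
    rw [Ne, Complex.exp_eq_one_iff]
    rintro ⟨n, hn⟩
    have hpi : (Real.pi : ℂ) ≠ 0 := Complex.ofReal_ne_zero.mpr Real.pi_ne_zero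
    have hm' : (m : ℂ) ≠ 0 := by exact_mod_cast hm0
    push_cast at hn
    field_simp at hn
    have hn' : j = 2 * m * n := by exact_mod_cast hn
    have hn0 : n ≠ 0 := by rintro rfl; simp at hn'; exact hj hn'
    have : 1 ≤ |n| := Int.one_le_abs hn0
    rw [hn', abs_mul, abs_mul] at hm
    have h5 := le_abs_self m
    have h6 := abs_nonneg m
    norm_num at hm
    nlinarith
  have h3 := integral_add_right_eq_self (μ := torusHaar)
    (fun z : Torus2 => fourier j z.2 * H (shear s m z)) (0, t)
  have h4 : ∀ z : Torus2, fourier j (z + (0, t)).2 * H (shear s m (z + (0, t))) =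
      fourier j t * (fourier j z.2 * H (shear s m z)) := by
    intro z
    rw [h1]
    simp [fourier_apply, AddCircle.toCircle_add]
    ring
  simp_rw [h4, integral_const_mul] at h3
  by_contra h5
  exact h2 (mul_right_cancel₀ h5 (h3.trans (one_mul _).symm))

/-! ### Trigonometric polynomials and restriction of their spectra. -/

/-- Trigonometric polynomials on the torus, as finitely supported families of coefficients. -/
abbrev TrigPoly : Type := AddMonoidAlgebra ℂ (ℤ × ℤ)

/-- Trigonometric polynomials in one variable. -/
abbrev TrigPoly1 : Type := AddMonoidAlgebra ℂ ℤ

/-- Evaluation of a trigonometric polynomial at a point of the torus. -/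
def evalAt (z : Torus2) : TrigPoly →ₐ[ℂ] ℂ :=
  AddMonoidAlgebra.lift ℂ ℂ (ℤ × ℤ)
    { toFun := fun p => character p.toAdd.1 p.toAdd.2 z
      map_one' := by simp
      map_mul' := fun p q => by simp [character_add] }

@[simp] theorem evalAt_single (z : Torus2) (p : ℤ × ℤ) (c : ℂ) :
    evalAt z (AddMonoidAlgebra.single p c) = c * character p.1 p.2 z := by
  simp [evalAt]

theorem evalAt_eq_sum (z : Torus2) (F : TrigPoly) :
    evalAt z F = ∑ p ∈ F.coeff.support, F.coeff p * character p.1 p.2 z := by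
  simp [evalAt, AddMonoidAlgebra.lift_apply, Finsupp.sum]

theorem continuous_evalAt (F : TrigPoly) : Continuous fun z => evalAt z F := by
  simp_rw [evalAt_eq_sum]
  exact continuous_finsetSum _ fun p _ => (continuous_character _ _).const_mul _

/-- A polynomial in one variable, viewed as a polynomial in the second variable. -/
def vert : TrigPoly1 →ₐ[ℂ] TrigPoly :=
  AddMonoidAlgebra.mapDomainAlgHom ℂ ℂ (AddMonoidHom.inr ℤ ℤ)

@[simp] theorem vert_single (j : ℤ) (c : ℂ) :
    vert (AddMonoidAlgebra.single j c) = AddMonoidAlgebra.single (0, j) c :=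
  AddMonoidAlgebra.mapDomain_single

/-- Evaluation of a one-variable polynomial at the second coordinate. -/
def evalVert (z : Torus2) : TrigPoly1 →ₐ[ℂ] ℂ := (evalAt z).comp vert

@[simp] theorem evalAt_vert (z : Torus2) (g : TrigPoly1) : evalAt z (vert g) = evalVert z g := rfl

@[simp] theorem evalVert_single (z : Torus2) (j : ℤ) (c : ℂ) :
    evalVert z (AddMonoidAlgebra.single j c) = c * fourier j z.2 := by
  rw [evalVert, AlgHom.comp_apply, vert_single, evalAt_single]
  simp [character]

theorem continuous_evalVert (g : TrigPoly1) : Continuous fun z => evalVert z g :=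
  continuous_evalAt (vert g)

theorem evalVert_eq_sum (z : Torus2) (g : TrigPoly1) :
    evalVert z g = ∑ j ∈ g.coeff.support, g.coeff j * fourier j z.2 := by
  conv_lhs => rw [← AddMonoidAlgebra.sum_coeff_single g]
  rw [Finsupp.sum, map_sum]
  simp only [evalVert_single]

/-- The action of `shear` on frequencies. -/
def shearFreq (s m : ℤ) : ℤ × ℤ →+ ℤ × ℤ where
  toFun p := (m * (p.1 + s * p.2), m * (2 * p.2))
  map_zero' := by simp
  map_add' p q := by ext <;> simp <;> ring

@[simp] theorem shearFreq_apply (s m : ℤ) (p : ℤ × ℤ) :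
    shearFreq s m p = (m * (p.1 + s * p.2), m * (2 * p.2)) := rfl

/-- Composition of a polynomial with `shear`. -/
def shearPoly (s m : ℤ) : TrigPoly →ₐ[ℂ] TrigPoly :=
  AddMonoidAlgebra.mapDomainAlgHom ℂ ℂ (shearFreq s m)

theorem evalAt_shearPoly (s m : ℤ) (F : TrigPoly) (z : Torus2) :
    evalAt z (shearPoly s m F) = evalAt (shear s m z) F := by
  have : (evalAt z).comp (shearPoly s m) = evalAt (shear s m z) := by
    refine AddMonoidAlgebra.algHom_ext' ?_ ?_
    · ext p
      simp [shearPoly, character_shear]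
    · ext
  exact DFunLike.congr_fun this F

/-- The part of a polynomial with frequencies in `P`. -/
def restrict (P : Set (ℤ × ℤ)) (F : TrigPoly) : TrigPoly := by
  classical exact .ofCoeff (F.coeff.filter (· ∈ P))

theorem coeff_restrict (P : Set (ℤ × ℤ)) [DecidablePred (· ∈ P)] (F : TrigPoly) :
    (restrict P F).coeff = F.coeff.filter (· ∈ P) := by
  unfold restrict
  congr!

theorem restrict_add (P : Set (ℤ × ℤ)) (F G : TrigPoly) :
    restrict P (F + G) = restrict P F + restrict P G := by
  classical
  ext1
  simp [coeff_restrict, Finsupp.filter_add]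

theorem restrict_eq_self {P : Set (ℤ × ℤ)} {F : TrigPoly} (h : ∀ p ∈ F.coeff.support, p ∈ P) :
    restrict P F = F := by
  classical
  ext1
  rw [coeff_restrict, Finsupp.filter_eq_self_iff]
  intro p hp
  exact h p (by simpa using hp)

theorem restrict_eq_zero {P : Set (ℤ × ℤ)} {F : TrigPoly} (h : ∀ p ∈ F.coeff.support, p ∉ P) :
    restrict P F = 0 := by
  classical
  ext1
  rw [coeff_restrict, AddMonoidAlgebra.coeff_zero, Finsupp.filter_eq_zero_iff]
  intro p hp
  by_contra h0
  exact h p (by simpa using h0) hp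

theorem restrict_add_restrict_compl (P : Set (ℤ × ℤ)) (F : TrigPoly) :
    restrict P F + restrict Pᶜ F = F := by
  classical
  ext p
  by_cases hp : p ∈ P <;> simp [coeff_restrict]

theorem mem_support_restrict {P : Set (ℤ × ℤ)} {F : TrigPoly} {p : ℤ × ℤ} :
    p ∈ (restrict P F).coeff.support ↔ p ∈ F.coeff.support ∧ p ∈ P := by
  classical
  rw [coeff_restrict, Finsupp.support_filter, Finset.mem_filter]

theorem mem_support_vert_mul_shearPoly {g : TrigPoly1} {s m : ℤ} {F : TrigPoly} {x : ℤ × ℤ}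
    (hx : x ∈ (vert g * shearPoly s m F).coeff.support) :
    ∃ j ∈ g.coeff.support, ∃ p ∈ F.coeff.support, x = (0, j) + shearFreq s m p := by
  classical
  have h := AddMonoidAlgebra.support_coeff_mul_subset _ _ hx
  obtain ⟨a, ha, b, hb, rfl⟩ := Finset.mem_add.mp h
  obtain ⟨j, hj, rfl⟩ := Finset.mem_image.mp (Finsupp.mapDomain_support ha)
  obtain ⟨p, hp, rfl⟩ := Finset.mem_image.mp (Finsupp.mapDomain_support hb)
  exact ⟨j, hj, p, hp, rfl⟩

/-- If the frequencies of `g` are too small to carry any sheared frequency across the boundary of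
`P`, truncation acts on `F` alone and the factor `g` comes out whole. -/
theorem restrict_vert_mul_shearPoly {g : TrigPoly1} {s m : ℤ} {F : TrigPoly}
    {P P' : Set (ℤ × ℤ)} (h : ∀ j ∈ g.coeff.support, ∀ p ∈ F.coeff.support,
      (0, j) + shearFreq s m p ∈ P ↔ p ∈ P') :
    restrict P (vert g * shearPoly s m F) = vert g * shearPoly s m (restrict P' F) := by
  conv_lhs => rw [← restrict_add_restrict_compl P' F, map_add, mul_add, restrict_add]
  rw [restrict_eq_self (F := vert g * shearPoly s m (restrict P' F)), 
    restrict_eq_zero (F := vert g * shearPoly s m (restrict P'ᶜ F)), add_zero]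
  · intro x hx
    obtain ⟨j, hj, p, hp, rfl⟩ := mem_support_vert_mul_shearPoly hx
    obtain ⟨hp, hp'⟩ := mem_support_restrict.mp hp
    rwa [h j hj p hp]
  · intro x hx
    obtain ⟨j, hj, p, hp, rfl⟩ := mem_support_vert_mul_shearPoly hx
    obtain ⟨hp, hp'⟩ := mem_support_restrict.mp hp
    rwa [h j hj p hp]

/-- The sum of the absolute values of the coefficients. -/
def coeffSum (F : TrigPoly) : ℝ := ∑ p ∈ F.coeff.support, ‖F.coeff p‖

theorem norm_evalAt_restrict_le (P : Set (ℤ × ℤ)) (F : TrigPoly) (z : Torus2) :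
    ‖evalAt z (restrict P F)‖ ≤ coeffSum F := by
  classical
  rw [evalAt_eq_sum, coeffSum]
  refine (norm_sum_le _ _).trans ?_
  simp_rw [norm_mul, norm_character, mul_one]
  rw [coeff_restrict, Finsupp.support_filter, Finset.sum_filter]
  refine Finset.sum_le_sum fun p _ => ?_
  split_ifs with h
  · rw [Finsupp.filter_apply_pos _ _ h]
  · exact norm_nonneg _

/-! ### Half-planes and cones under shears. -/

/-- The frequencies to the left of the line through the origin with slope `t` against the
vertical axis. -/
def leftHalf (t : ℝ) : Set (ℤ × ℤ) := {p | (p.1 : ℝ) < t * p.2}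

theorem mem_leftHalf {t : ℝ} {p : ℤ × ℤ} : p ∈ leftHalf t ↔ (p.1 : ℝ) < t * p.2 := Iff.rfl

theorem eventually_mul_lt_iff {l : ℝ} (hl : l ≠ 0) (c : ℝ) :
    ∀ᶠ m : ℤ in atTop, (m * l < c ↔ l < 0) ∧ m * l ≠ c := by
  have h := tendsto_intCast_atTop_atTop (R := ℝ)
  rcases lt_or_gt_of_ne hl with h0 | h0
  · filter_upwards [(h.atTop_mul_const_of_neg h0).eventually_lt_atBot c] with m hm
    exact ⟨by simp [hm, h0], hm.ne⟩
  · filter_upwards [(h.atTop_mul_const h0).eventually_gt_atTop c] with m hm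
    exact ⟨by simp [hm.le, h0.le, not_lt.mpr], hm.ne'⟩

/-- The position of the new frequency relative to the line `t` is decided by comparing `m * (p.1 -
(2 * t - s) * p.2)` with `t * j`. The linear form is nonzero on the finite support, so for large `m`
its sign decides: the slope `t` for the product is the slope `2 * t - s` for `F`. -/
theorem eventually_shear_mem_leftHalf (g : TrigPoly1) {F : TrigPoly} (s : ℤ) {t : ℝ}
    (hF : ∀ p ∈ F.coeff.support, (p.1 : ℝ) ≠ (2 * t - s) * p.2) :
    ∀ᶠ m : ℤ in atTop, ∀ j ∈ g.coeff.support, ∀ p ∈ F.coeff.support,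
      ((0, j) + shearFreq s m p ∈ leftHalf t ↔ p ∈ leftHalf (2 * t - s)) ∧
      (((0, j) + shearFreq s m p).1 : ℝ) ≠ t * ((0, j) + shearFreq s m p).2 := by
  simp_rw [eventually_all_finset]
  intro j _ p hp
  have hl : (p.1 : ℝ) - (2 * t - s) * p.2 ≠ 0 := sub_ne_zero.mpr (hF p hp)
  filter_upwards [eventually_mul_lt_iff hl (t * j)] with m hm
  rw [mem_leftHalf, mem_leftHalf, ← sub_neg (a := (p.1 : ℝ)), ← hm.1]
  simp only [shearFreq_apply, Prod.mk_add_mk]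
  push_cast
  constructor
  · constructor <;> intro h <;> linarith
  · intro h
    apply hm.2
    linarith

/-- Integrality gives `|p.1| + |p.2| ≤ 2 * |p.2| - 1`; after dilation the gap is at least `m`, which
absorbs the shift by `j`. -/
theorem eventually_shear_abs_lt (g : TrigPoly1) {F : TrigPoly} {s : ℤ} (hs : |s| = 1)
    (hF : ∀ p ∈ F.coeff.support, |p.1| < |p.2|) :
    ∀ᶠ m : ℤ in atTop, ∀ j ∈ g.coeff.support, ∀ p ∈ F.coeff.support,
      |((0, j) + shearFreq s m p).1| < |((0, j) + shearFreq s m p).2| := by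
  simp_rw [eventually_all_finset]
  intro j _ p hp
  filter_upwards [eventually_gt_atTop |j|] with m hm
  have h0 := hF p hp
  have hm0 : 0 < m := (abs_nonneg j).trans_lt hm
  simp only [shearFreq_apply, Prod.mk_add_mk, zero_add]
  have h1 : |m * (p.1 + s * p.2)| ≤ m * (|p.1| + |p.2|) := by
    rw [abs_mul, abs_of_pos hm0]
    gcongr
    refine (abs_add_le _ _).trans ?_
    rw [abs_mul, hs, one_mul]
  have h2 : m * (2 * |p.2|) - |j| ≤ |j + m * (2 * p.2)| := by
    have := abs_sub_abs_le_abs_sub (m * (2 * p.2)) (-j)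
    rw [abs_neg, abs_mul, abs_mul, abs_of_pos hm0, sub_neg_eq_add, add_comm _ j] at this
    simpa using this
  nlinarith

/-- Only the constant term of `g` correlates with a function of `shear s m z` once `m` exceeds every
frequency of `g`. The bound on `m` is uniform in `H`. -/
theorem eventually_integral_evalVert_mul (g : TrigPoly1) :
    ∀ᶠ m : ℤ in atTop, ∀ (s : ℤ) (H : C(Torus2, ℂ)),
      ∫ z, evalVert z g * H (shear s m z) ∂torusHaar =
        (∫ z, evalVert z g ∂torusHaar) * ∫ z, H z ∂torusHaar := by
  have h : ∀ᶠ m : ℤ in atTop, ∀ j ∈ g.coeff.support, |j| < m := by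
    simp_rw [eventually_all_finset]
    exact fun j _ => eventually_gt_atTop _
  filter_upwards [h, eventually_gt_atTop 0] with m hm hm0 s H
  have hc : ∀ j : ℤ, Continuous fun z : Torus2 => (fourier j z.2 : ℂ) := fun j => by fun_prop
  have hH : Continuous fun z => H (shear s m z) := H.continuous.comp (continuous_shear s m)
  have hint : ∀ f : Torus2 → ℂ, Continuous f → Integrable f torusHaar := fun f hf =>
    hf.integrable_of_hasCompactSupport (HasCompactSupport.of_compactSpace f)
  simp_rw [evalVert_eq_sum, Finset.sum_mul]
  rw [integral_finsetSum _ fun j _ => hint (fun z => g.coeff j * fourier j z.2 * H (shear s m z))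
      (((hc j).const_mul _).mul hH),
    integral_finsetSum _ fun j _ => hint (fun z => g.coeff j * fourier j z.2)
      ((hc j).const_mul _), Finset.sum_mul]
  refine Finset.sum_congr rfl fun j hj => ?_
  simp_rw [mul_assoc, integral_const_mul]
  rw [mul_assoc]
  congr 1
  by_cases hj0 : j = 0
  · subst hj0
    simp only [fourier_zero, one_mul, integral_const, probReal_univ, one_smul]
    exact integral_comp_shear s hm0.ne' H
  · rw [integral_fourier_mul_comp_shear hj0 s (hm j hj)]
    have := integral_character_of_ne (n := 0) (m := j) (by simpa using hj0)
    simp only [character, fourier_zero, one_mul] at this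
    rw [this, zero_mul]

/-! ### Sine, cosine and polynomial approximation of the sign of `sin y`. -/

/-- The cosine of the second coordinate. -/
def cosSnd (z : Torus2) : ℝ := (fourier 1 z.2 : ℂ).re

/-- The sine of the second coordinate. -/
def sinSnd (z : Torus2) : ℝ := (fourier 1 z.2 : ℂ).im

theorem continuous_sinSnd : Continuous sinSnd := by unfold sinSnd; fun_prop

theorem cosSnd_sq_add_sinSnd_sq (z : Torus2) : cosSnd z ^ 2 + sinSnd z ^ 2 = 1 := by
  have h : ‖(fourier 1 z.2 : ℂ)‖ = 1 := by rw [fourier_apply, Circle.norm_coe]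
  rw [← Complex.normSq_add_mul_I, cosSnd, sinSnd, Complex.re_add_im, Complex.normSq_eq_norm_sq, h]
  norm_num

theorem sinSnd_mem_Icc (z : Torus2) : sinSnd z ∈ Set.Icc (-1) 1 := by
  have := cosSnd_sq_add_sinSnd_sq z
  constructor <;> nlinarith [sq_nonneg (cosSnd z)]

theorem fourier_one_snd (z : Torus2) :
    (fourier 1 z.2 : ℂ) = cosSnd z + sinSnd z * Complex.I := (Complex.re_add_im _).symm

theorem fourier_neg_one_snd (z : Torus2) :
    (fourier (-1) z.2 : ℂ) = cosSnd z - sinSnd z * Complex.I := by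
  rw [fourier_neg, fourier_one_snd]
  simp [sub_eq_add_neg]

/-- The cosine as a trigonometric polynomial. -/
def cosPoly : TrigPoly1 := AddMonoidAlgebra.single 1 (1 / 2) + AddMonoidAlgebra.single (-1) (1 / 2)

/-- The sine as a trigonometric polynomial. -/
def sinPoly : TrigPoly1 :=
  AddMonoidAlgebra.single 1 (-Complex.I / 2) + AddMonoidAlgebra.single (-1) (Complex.I / 2)

@[simp] theorem evalVert_cosPoly (z : Torus2) : evalVert z cosPoly = cosSnd z := by
  rw [cosPoly, map_add, evalVert_single, evalVert_single, fourier_one_snd, fourier_neg_one_snd]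
  ring

@[simp] theorem evalVert_sinPoly (z : Torus2) : evalVert z sinPoly = sinSnd z := by
  rw [sinPoly, map_add, evalVert_single, evalVert_single, fourier_one_snd, fourier_neg_one_snd]
  linear_combination (-(sinSnd z : ℂ)) * Complex.I_sq

theorem integral_fourier_snd {j : ℤ} (hj : j ≠ 0) :
    ∫ z : Torus2, (fourier j z.2 : ℂ) ∂torusHaar = 0 := by
  have := integral_character_of_ne (n := 0) (m := j) (by simpa using hj)
  simpa only [character, fourier_zero, one_mul] using this

theorem integrable_of_continuous {E : Type*} [NormedAddCommGroup E] {f : Torus2 → E}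
    (hf : Continuous f) : Integrable f torusHaar :=
  hf.integrable_of_hasCompactSupport (HasCompactSupport.of_compactSpace f)

theorem continuous_cosSnd : Continuous cosSnd := by unfold cosSnd; fun_prop

theorem integral_cosSnd : ∫ z, cosSnd z ∂torusHaar = 0 := by
  have h := integral_fourier_snd one_ne_zero
  have h2 := integral_re (𝕜 := ℂ) (μ := torusHaar) (f := fun z : Torus2 => (fourier 1 z.2 : ℂ))
    (integrable_of_continuous (by fun_prop))
  rw [h] at h2
  simpa [cosSnd] using h2

theorem integral_sinSnd_sq : ∫ z, sinSnd z ^ 2 ∂torusHaar = 1 / 2 := by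
  have h := integral_fourier_snd (j := 2) two_ne_zero
  have h2 := integral_re (𝕜 := ℂ) (μ := torusHaar) (f := fun z : Torus2 => (fourier 2 z.2 : ℂ))
    (integrable_of_continuous (by fun_prop))
  rw [h] at h2
  have h3 : ∀ z : Torus2, sinSnd z ^ 2 = 1 / 2 - (1 / 2) * RCLike.re (fourier 2 z.2 : ℂ) := by
    intro z
    have h4 : (fourier 2 z.2 : ℂ) = fourier 1 z.2 * fourier 1 z.2 := by
      rw [← fourier_add]; norm_num
    rw [h4, fourier_one_snd]
    have := cosSnd_sq_add_sinSnd_sq z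
    simp
    linarith
  simp_rw [h3]
  rw [integral_sub (integrable_const _)
    ((integrable_of_continuous (by fun_prop)).const_mul _), integral_const_mul, h2]
  simp

theorem exists_step_polynomial {δ ε : ℝ} (hδ : 0 < δ) (hε : 0 < ε) :
    ∃ P : Polynomial ℝ, ∀ s ∈ Set.Icc (-1 : ℝ) 1, 0 ≤ P.eval s ∧ P.eval s ≤ 1 ∧
      (δ ≤ s → 1 - ε ≤ P.eval s) ∧ (s ≤ -δ → P.eval s ≤ ε) := by
  -- Weierstrass approximation of a ramp from 0 to 1 over `[-δ, δ]`; adding `ε / 2` and dividing by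
  -- `1 + ε` then brings the values back into `[0, 1]`.
  obtain ⟨p, hp⟩ := exists_polynomial_near_of_continuousOn (-1) 1
    (fun s : ℝ => max 0 (min 1 (1 / 2 + s / (2 * δ)))) (by fun_prop) (ε / 2) (by positivity)
  refine ⟨Polynomial.C (1 / (1 + ε)) * (p + Polynomial.C (ε / 2)), fun s hs => ?_⟩
  have h := abs_lt.mp (hp s hs)
  simp only [Polynomial.eval_mul, Polynomial.eval_C, Polynomial.eval_add]
  have h0 : 0 ≤ max 0 (min 1 (1 / 2 + s / (2 * δ))) := le_max_left _ _
  have h1 : max 0 (min 1 (1 / 2 + s / (2 * δ))) ≤ 1 := max_le zero_le_one (min_le_left _ _)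
  have h2 : 0 < 1 + ε := by positivity
  rw [one_div_mul_eq_div]
  refine ⟨div_nonneg (by linarith) h2.le, (div_le_one h2).mpr (by linarith), fun hs' => ?_,
    fun hs' => ?_⟩
  · have h3 : max 0 (min 1 (1 / 2 + s / (2 * δ))) = 1 := by
      have : 1 / 2 ≤ s / (2 * δ) := by rw [le_div_iff₀ (by positivity)]; linarith
      rw [min_eq_left (by linarith), max_eq_right zero_le_one]
    rw [h3] at h
    rw [le_div_iff₀ h2]
    nlinarith
  · have h3 : max 0 (min 1 (1 / 2 + s / (2 * δ))) = 0 := by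
      have : s / (2 * δ) ≤ -(1 / 2) := by rw [div_le_iff₀ (by positivity)]; linarith
      exact max_eq_left ((min_le_right _ _).trans (by linarith))
    rw [h3] at h
    rw [div_le_iff₀ h2]
    nlinarith

instance haarAddCircle_nullSingletonClass :
    NullSingletonClass (AddCircle.haarAddCircle : Measure (AddCircle (2 * Real.pi))) where
  measure_singleton x := by
    have h := AddCircle.volume_closedBall (2 * Real.pi) (x := x) 0
    rw [Metric.closedBall_zero, mul_zero, min_eq_right Real.two_pi_pos.le, ENNReal.ofReal_zero,
      AddCircle.volume_eq_smul_haarAddCircle, Measure.smul_apply, smul_eq_mul, mul_eq_zero] at h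
    exact h.resolve_left (ENNReal.ofReal_pos.mpr Real.two_pi_pos).ne'

theorem torusHaar_sinSnd_eq_zero : torusHaar {z | sinSnd z = 0} = 0 := by
  have hfin : {y : AddCircle (2 * Real.pi) | (2 : ℕ) • y = 0}.Finite :=
    AddCircle.finite_torsion (2 * Real.pi) two_pos
  have hsub : {z : Torus2 | sinSnd z = 0} ⊆
      Set.univ ×ˢ {y : AddCircle (2 * Real.pi) | (2 : ℕ) • y = 0} := by
    intro z hz
    refine ⟨trivial, ?_⟩
    have h1 := cosSnd_sq_add_sinSnd_sq z
    have hz' : sinSnd z = 0 := hz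
    have h4 : (fourier 2 z.2 : ℂ) = 1 := by
      have : (fourier 2 z.2 : ℂ) = fourier 1 z.2 * fourier 1 z.2 := by
        rw [← fourier_add]; norm_num
      rw [this, fourier_one_snd, hz']
      rw [hz'] at h1
      have : (cosSnd z : ℂ) ^ 2 = 1 := by
        exact_mod_cast (by linarith : cosSnd z ^ 2 = 1)
      push_cast
      linear_combination this
    rw [fourier_apply] at h4
    have h5 : AddCircle.toCircle ((2 : ℤ) • z.2) =
        AddCircle.toCircle (0 : AddCircle (2 * Real.pi)) := by
      rw [AddCircle.toCircle_zero]; exact Circle.ext (by simpa using h4)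
    have h6 := AddCircle.injective_toCircle Real.two_pi_pos.ne' h5
    exact (natCast_zsmul z.2 2).symm.trans h6
  refine measure_mono_null hsub ?_
  rw [torusHaar, Measure.prod_prod, hfin.measure_zero, mul_zero]

/-- The strip where the step function is uncontrolled shrinks to the null set of zeros of the sine.
The bound `1 / 8` makes its effect on the drift harmless in `exists_stepPoly`. -/
theorem exists_sinSnd_small {ε : ENNReal} (hε : 0 < ε) :
    ∃ δ : ℝ, 0 < δ ∧ δ ≤ 1 / 8 ∧ torusHaar {z | |sinSnd z| ≤ δ} ≤ ε := by
  let S : ℕ → Set Torus2 := fun n => {z | |sinSnd z| ≤ 1 / (n + 8)}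
  have hS : Antitone S := by
    intro a b hab z hz
    refine le_trans (show |sinSnd z| ≤ _ from hz) ?_
    gcongr
  have hmeas : ∀ n, NullMeasurableSet (S n) torusHaar := fun n =>
    (isClosed_le continuous_sinSnd.abs continuous_const).measurableSet.nullMeasurableSet
  have h := tendsto_measure_iInter_atTop hmeas hS ⟨0, measure_ne_top _ _⟩
  have h0 : ⋂ n, S n ⊆ {z | sinSnd z = 0} := by
    intro z hz
    have h1 : Tendsto (fun n : ℕ => (1 : ℝ) / (n + 8)) atTop (𝓝 0) :=
      tendsto_const_nhds.div_atTop
        (tendsto_atTop_add_const_right _ _ tendsto_natCast_atTop_atTop)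
    have h2 := ge_of_tendsto' h1 fun n => (Set.mem_iInter.mp hz n : |sinSnd z| ≤ _)
    exact abs_eq_zero.mp (le_antisymm h2 (abs_nonneg _))
  rw [measure_mono_null h0 torusHaar_sinSnd_eq_zero] at h
  obtain ⟨n, hn⟩ := (h.eventually_le_const hε).exists
  refine ⟨1 / (n + 8), by positivity, ?_, hn⟩
  gcongr
  simp

/-! ### The recursive step and its half-plane sums. -/

/-- The one-variable polynomial `1 + i a cos y`. -/
def modFactor (a : ℝ) : TrigPoly1 := 1 + (Complex.I * a) • cosPoly

@[simp] theorem evalVert_modFactor (a : ℝ) (z : Torus2) :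
    evalVert z (modFactor a) = 1 + Complex.I * a * cosSnd z := by
  simp [modFactor]

theorem normSq_one_add_I_mul (x : ℝ) : ‖(1 + Complex.I * x : ℂ)‖ ^ 2 = 1 + x ^ 2 := by
  rw [← Complex.normSq_eq_norm_sq, mul_comm, ← Complex.ofReal_one, Complex.normSq_add_mul_I]
  norm_num

theorem norm_modFactor_sq_le (a : ℝ) (z : Torus2) :
    ‖(1 + Complex.I * a * cosSnd z : ℂ)‖ ^ 2 ≤ 1 + a ^ 2 := by
  have h := normSq_one_add_I_mul (a * cosSnd z)
  push_cast at h
  rw [mul_assoc, h]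
  have := cosSnd_sq_add_sinSnd_sq z
  nlinarith [sq_nonneg (sinSnd z), sq_nonneg a, mul_nonneg (sq_nonneg a) (sq_nonneg (sinSnd z))]

theorem norm_modFactor_le {a : ℝ} (ha : 0 ≤ a) (z : Torus2) :
    ‖(1 + Complex.I * a * cosSnd z : ℂ)‖ ≤ 1 + a := by
  refine (le_abs_self _).trans (abs_le_of_sq_le_sq ?_ (by positivity))
  nlinarith [norm_modFactor_sq_le a z]

/-- The polynomial whose value at `(x, y)`, increased by `1`, is
`(1 + i a cos y) (q (1 + F₊) + (1 - q) (1 + F₋))`, with `F₊` and `F₋` the two shears of `F`. -/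
def nextPoly (a : ℝ) (q : TrigPoly1) (m : ℤ) (F : TrigPoly) : TrigPoly :=
  vert ((Complex.I * a) • cosPoly) + vert (modFactor a * q) * shearPoly 1 m F +
    vert (modFactor a * (1 - q)) * shearPoly (-1) m F

theorem one_add_evalAt_nextPoly (a : ℝ) (q : TrigPoly1) (m : ℤ) (F : TrigPoly) (z : Torus2) :
    1 + evalAt z (nextPoly a q m F) = (1 + Complex.I * a * cosSnd z) *
      (evalVert z q * (1 + evalAt (shear 1 m z) F) +
        (1 - evalVert z q) * (1 + evalAt (shear (-1) m z) F)) := by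
  simp only [nextPoly, map_add, map_mul, map_sub, map_one, map_smul, evalAt_vert,
    evalAt_shearPoly, evalVert_modFactor, evalVert_cosPoly, smul_eq_mul]
  ring

theorem norm_convex_sq_le {Q : ℝ} (h0 : 0 ≤ Q) (h1 : Q ≤ 1) (x y : ℂ) :
    ‖(Q : ℂ) * x + (1 - Q) * y‖ ^ 2 ≤ Q * ‖x‖ ^ 2 + (1 - Q) * ‖y‖ ^ 2 := by
  have h : ‖(Q : ℂ) * x + (1 - Q) * y‖ ≤ Q * ‖x‖ + (1 - Q) * ‖y‖ := by
    refine (norm_add_le _ _).trans (le_of_eq ?_)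
    have e : (1 - Q : ℂ) = ((1 - Q : ℝ) : ℂ) := by push_cast; ring
    rw [norm_mul, norm_mul, e, Complex.norm_of_nonneg h0, Complex.norm_of_nonneg (by linarith)]
  have h2 : ‖(Q : ℂ) * x + (1 - Q) * y‖ ^ 2 ≤ (Q * ‖x‖ + (1 - Q) * ‖y‖) ^ 2 := by gcongr
  nlinarith [mul_nonneg (mul_nonneg h0 (sub_nonneg.mpr h1)) (sq_nonneg (‖x‖ - ‖y‖))]

/-- The two shears enter through a convex combination, so only the modulating factor can increase
the bound. -/
theorem norm_one_add_nextPoly_sq_le {a C : ℝ} {q : TrigPoly1} {m : ℤ} {F : TrigPoly}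
    {Q : Torus2 → ℝ} (hq : ∀ z, evalVert z q = Q z) (hQ : ∀ z, 0 ≤ Q z ∧ Q z ≤ 1)
    (hF : ∀ z, ‖1 + evalAt z F‖ ^ 2 ≤ C) (z : Torus2) :
    ‖1 + evalAt z (nextPoly a q m F)‖ ^ 2 ≤ (1 + a ^ 2) * C := by
  rw [one_add_evalAt_nextPoly, norm_mul, mul_pow, hq]
  refine mul_le_mul (norm_modFactor_sq_le a z) ?_ (by positivity) (by positivity)
  refine (norm_convex_sq_le (hQ z).1 (hQ z).2 _ _).trans ?_
  have h1 := mul_le_mul_of_nonneg_left (hF (shear 1 m z)) (hQ z).1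
  have h2 := mul_le_mul_of_nonneg_left (hF (shear (-1) m z)) (sub_nonneg.mpr (hQ z).2)
  linarith

theorem mem_support_nextPoly {a : ℝ} {q : TrigPoly1} {m : ℤ} {F : TrigPoly} {x : ℤ × ℤ}
    (hx : x ∈ (nextPoly a q m F).coeff.support) :
    x = (0, 1) ∨ x = (0, -1) ∨
      (∃ j ∈ (modFactor a * q).coeff.support, ∃ p ∈ F.coeff.support,
        x = (0, j) + shearFreq 1 m p) ∨
      ∃ j ∈ (modFactor a * (1 - q)).coeff.support, ∃ p ∈ F.coeff.support,
        x = (0, j) + shearFreq (-1) m p := by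
  classical
  rw [nextPoly, AddMonoidAlgebra.coeff_add, AddMonoidAlgebra.coeff_add] at hx
  rcases Finset.mem_union.mp (Finsupp.support_add hx) with hx | hx
  · rcases Finset.mem_union.mp (Finsupp.support_add hx) with hx | hx
    · simp only [cosPoly, smul_add, AddMonoidAlgebra.smul_single, map_add, vert_single,
        AddMonoidAlgebra.coeff_add, AddMonoidAlgebra.coeff_single] at hx
      rcases Finset.mem_union.mp (Finsupp.support_add hx) with hx | hx
      · exact .inl (Finset.mem_singleton.mp (Finsupp.support_single_subset hx))
      · exact .inr (.inl (Finset.mem_singleton.mp (Finsupp.support_single_subset hx)))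
    · exact .inr (.inr (.inl (mem_support_vert_mul_shearPoly hx)))
  · exact .inr (.inr (.inr (mem_support_vert_mul_shearPoly hx)))

/-- The frequencies `(0, ±1)` lie on the vertical axis, so only the sign of `t` decides which one
survives. -/
theorem evalAt_restrict_cos {a t : ℝ} (z : Torus2) (ht : t ≠ 0) :
    evalAt z (restrict (leftHalf t) (vert ((Complex.I * a) • cosPoly))) =
      Complex.I * a / 2 * fourier (if 0 < t then 1 else -1) z.2 := by
  classical
  have key : ∀ (j : ℤ) (c : ℂ),
      evalAt z (restrict (leftHalf t) (AddMonoidAlgebra.single (0, j) c)) =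
      if 0 < t * j then c * fourier j z.2 else 0 := by
    intro j c
    split_ifs with h
    · rw [restrict_eq_self]
      · rw [evalAt_single]; simp [character]
      · intro p hp
        rw [AddMonoidAlgebra.coeff_single] at hp
        rw [Finset.mem_singleton.mp (Finsupp.support_single_subset hp), mem_leftHalf]
        simpa using h
    · rw [restrict_eq_zero, map_zero]
      intro p hp
      rw [AddMonoidAlgebra.coeff_single] at hp
      rw [Finset.mem_singleton.mp (Finsupp.support_single_subset hp), mem_leftHalf]
      simpa using h
  simp only [cosPoly, smul_add, AddMonoidAlgebra.smul_single, map_add, vert_single, restrict_add,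
    key, smul_eq_mul]
  rcases lt_or_gt_of_ne ht with h | h
  · have h' : ¬ 0 < t := h.le.not_gt
    simp [h, h']
    ring
  · have h' : ¬ t < 0 := h.le.not_gt
    simp [h, h']
    ring

theorem evalAt_restrict_nextPoly {a t : ℝ} {q : TrigPoly1} {m : ℤ} {F : TrigPoly} (ht : t ≠ 0)
    (h1 : ∀ j ∈ (modFactor a * q).coeff.support, ∀ p ∈ F.coeff.support,
      ((0, j) + shearFreq 1 m p ∈ leftHalf t ↔ p ∈ leftHalf (2 * t - 1)))
    (h2 : ∀ j ∈ (modFactor a * (1 - q)).coeff.support, ∀ p ∈ F.coeff.support,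
      ((0, j) + shearFreq (-1) m p ∈ leftHalf t ↔ p ∈ leftHalf (2 * t + 1))) (z : Torus2) :
    evalAt z (restrict (leftHalf t) (nextPoly a q m F)) =
      Complex.I * a / 2 * fourier (if 0 < t then 1 else -1) z.2 +
      (1 + Complex.I * a * cosSnd z) *
        (evalVert z q * evalAt (shear 1 m z) (restrict (leftHalf (2 * t - 1)) F) +
        (1 - evalVert z q) * evalAt (shear (-1) m z) (restrict (leftHalf (2 * t + 1)) F)) := by
  rw [nextPoly, restrict_add, restrict_add, restrict_vert_mul_shearPoly h1,
    restrict_vert_mul_shearPoly h2, map_add, map_add, evalAt_restrict_cos z ht]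
  simp only [map_mul, map_sub, map_one, evalAt_vert, evalAt_shearPoly, evalVert_modFactor]
  ring

/-! ### The continuous model of the selected sums: error, mean and variance. -/

/-- `W ∘ shear s m` as a continuous map. -/
def compShear (s m : ℤ) (W : C(Torus2, ℂ)) : C(Torus2, ℂ) :=
  ⟨_, W.continuous.comp (continuous_shear s m)⟩

/-- The model for the partial sums of `nextPoly`, given a model `W` for those of `F`. -/
def nextModel (a : ℝ) (q : TrigPoly1) (m : ℤ) (W : C(Torus2, ℂ)) : C(Torus2, ℂ) where
  toFun z := evalVert z q * (Complex.I * a / 2 * fourier 1 z.2 +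
        (1 + Complex.I * a * cosSnd z) * compShear 1 m W z) +
      (1 - evalVert z q) * (Complex.I * a / 2 * fourier (-1) z.2 +
        (1 + Complex.I * a * cosSnd z) * compShear (-1) m W z)
  continuous_toFun := by
    have h1 := continuous_evalVert q
    have h2 := continuous_cosSnd
    fun_prop

theorem nextModel_apply (a : ℝ) (q : TrigPoly1) (m : ℤ) (W : C(Torus2, ℂ)) (z : Torus2) :
    nextModel a q m W z = evalVert z q * (Complex.I * a / 2 * fourier 1 z.2 +
        (1 + Complex.I * a * cosSnd z) * W (shear 1 m z)) +
      (1 - evalVert z q) * (Complex.I * a / 2 * fourier (-1) z.2 +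
        (1 + Complex.I * a * cosSnd z) * W (shear (-1) m z)) := rfl

theorem norm_fourier_apply (j : ℤ) (y : AddCircle (2 * Real.pi)) : ‖(fourier j y : ℂ)‖ = 1 := by
  rw [fourier_apply, Circle.norm_coe]

/-- At a fixed point the true sum uses one slope for both branches, whereas the model uses the
favourable sign in each. The branch of weight `1 - Q ≤ e` is wrong but bounded, and the other is
accurate up to `η`. The roles of the branches may be exchanged by replacing `Q` with `1 - Q`. -/
theorem norm_sub_model_le {a e η K : ℝ} (ha : 0 ≤ a) {Q : ℝ} (hQ0 : 0 ≤ Q) (hQ1 : Q ≤ 1)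
    (hQe : 1 - Q ≤ e) {u v R S T X Y : ℂ} (hu : ‖u‖ = 1) (hv : ‖v‖ = 1) (hR : ‖R‖ ≤ 1 + a)
    (hS : ‖S - X‖ ≤ η) (hT : ‖T‖ ≤ K) (hY : ‖Y‖ ≤ K) :
    ‖(Complex.I * a / 2 * u + R * (Q * S + (1 - Q) * T)) -
      (Q * (Complex.I * a / 2 * u + R * X) + (1 - Q) * (Complex.I * a / 2 * v + R * Y))‖ ≤
      (1 + a) * η + e * (a + (1 + a) * (2 * K)) := by
  have e1 : (Complex.I * a / 2 * u + R * (Q * S + (1 - Q) * T)) -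
      (Q * (Complex.I * a / 2 * u + R * X) + (1 - Q) * (Complex.I * a / 2 * v + R * Y)) =
      (Q : ℂ) * (R * (S - X)) +
        ((1 - Q : ℝ) : ℂ) * (Complex.I * a / 2 * (u - v) + R * (T - Y)) := by
    push_cast; ring
  have hK : 0 ≤ K := (norm_nonneg _).trans hT
  have hη : 0 ≤ η := (norm_nonneg _).trans hS
  have h1 : ‖(Q : ℂ) * (R * (S - X))‖ ≤ 1 * ((1 + a) * η) := by
    rw [norm_mul, norm_mul, Complex.norm_of_nonneg hQ0]
    gcongr
  have h2 : ‖Complex.I * a / 2 * (u - v) + R * (T - Y)‖ ≤ a + (1 + a) * (2 * K) := by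
    have h3 : ‖u - v‖ ≤ 2 := (norm_sub_le _ _).trans (by rw [hu, hv]; norm_num)
    have h4 : ‖T - Y‖ ≤ 2 * K := (norm_sub_le _ _).trans (by linarith)
    have h5 : ‖(Complex.I * a / 2 : ℂ)‖ = a / 2 := by
      rw [norm_div, norm_mul, Complex.norm_I, Complex.norm_of_nonneg ha, one_mul]
      norm_num
    refine (norm_add_le _ _).trans ?_
    rw [norm_mul, norm_mul, h5]
    have : a / 2 * ‖u - v‖ ≤ a / 2 * 2 := by gcongr
    have : ‖R‖ * ‖T - Y‖ ≤ (1 + a) * (2 * K) := by gcongr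
    linarith
  rw [e1]
  refine (norm_add_le _ _).trans ?_
  rw [norm_mul (((1 - Q : ℝ) : ℂ)), Complex.norm_of_nonneg (sub_nonneg.mpr hQ1)]
  have h3 : (1 - Q) * ‖Complex.I * a / 2 * (u - v) + R * (T - Y)‖ ≤
      e * (a + (1 + a) * (2 * K)) := by gcongr; linarith
  linarith

/-- Functions of the form `H ∘ shear s m` are uncorrelated with the polynomial `g`. -/
def IsUncorrelated (g : TrigPoly1) (m : ℤ) : Prop :=
  ∀ (s : ℤ) (H : C(Torus2, ℂ)), ∫ z, evalVert z g * H (shear s m z) ∂torusHaar =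
    (∫ z, evalVert z g ∂torusHaar) * ∫ z, H z ∂torusHaar

/-- By decorrelation the old mean is multiplied by the integral of `1 + i a cos y`, which is 1. What
is added is the drift, coming from `i * i = -1` in front of the sine. -/
theorem integral_nextModel {a μ : ℝ} {q : TrigPoly1} {m : ℤ} {W : C(Torus2, ℂ)} {Q : Torus2 → ℝ}
    (hq : ∀ z, evalVert z q = Q z) (h1 : IsUncorrelated (modFactor a * q) m)
    (h2 : IsUncorrelated (modFactor a * (1 - q)) m) (hW : ∫ z, W z ∂torusHaar = μ) :
    ∫ z, nextModel a q m W z ∂torusHaar =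
      ((μ - a / 2 * ∫ z, (2 * Q z - 1) * sinSnd z ∂torusHaar : ℝ) : ℂ) := by
  have hs : ∀ s : ℤ, Continuous fun z => W (shear s m z) := fun s =>
    W.continuous.comp (continuous_shear s m)
  have e : ∀ z, nextModel a q m W z = (Complex.I * a / 2 * cosSnd z -
      ((a / 2 * ((2 * Q z - 1) * sinSnd z) : ℝ) : ℂ)) +
      (evalVert z (modFactor a * q) * W (shear 1 m z) +
        evalVert z (modFactor a * (1 - q)) * W (shear (-1) m z)) := by
    intro z
    rw [nextModel_apply, map_mul, map_mul, map_sub, map_one, evalVert_modFactor, hq,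
      fourier_one_snd, fourier_neg_one_snd]
    push_cast
    linear_combination (a / 2 * (2 * Q z - 1) * sinSnd z : ℂ) * Complex.I_sq
  have hQc : Continuous Q := by
    have : Q = fun z => (evalVert z q).re := by ext z; rw [hq, Complex.ofReal_re]
    rw [this]
    exact Complex.continuous_re.comp (continuous_evalVert q)
  have hsin := continuous_sinSnd
  have hcos := continuous_cosSnd
  have c1 : Continuous fun z => evalVert z (modFactor a * q) * W (shear 1 m z) :=
    (continuous_evalVert _).mul (hs 1)
  have c2 : Continuous fun z => evalVert z (modFactor a * (1 - q)) * W (shear (-1) m z) :=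
    (continuous_evalVert _).mul (hs (-1))
  simp_rw [e]
  rw [integral_add (integrable_of_continuous (by fun_prop))
      (integrable_of_continuous (by exact c1.add c2)),
    integral_add (integrable_of_continuous c1) (integrable_of_continuous c2), h1, h2, hW,
    integral_sub (integrable_of_continuous (by fun_prop)) (integrable_of_continuous (by fun_prop)),
    integral_const_mul, integral_complex_ofReal, integral_complex_ofReal, integral_cosSnd,
    integral_const_mul,
    ← add_mul, ← integral_add (integrable_of_continuous (continuous_evalVert _))
      (integrable_of_continuous (continuous_evalVert _))]
  have e2 : ∀ z, evalVert z (modFactor a * q) + evalVert z (modFactor a * (1 - q)) =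
      1 + Complex.I * a * cosSnd z := by
    intro z
    rw [← map_add, ← mul_add, add_sub_cancel, mul_one, evalVert_modFactor]
  simp_rw [e2]
  rw [integral_add (integrable_const _) (integrable_of_continuous (by fun_prop)),
    integral_const_mul, integral_complex_ofReal, integral_cosSnd]
  simp
  ring

/-- The complex conjugate of the part of `nextModel - mean` that depends on `y` only. -/
def driftPoly (a μ s : ℝ) (q : TrigPoly1) : TrigPoly1 :=
  (-(Complex.I * a / 2 * (1 + 2 * μ))) • cosPoly -
    (a / 2 : ℂ) • ((2 * q - 1) * sinPoly - algebraMap ℂ TrigPoly1 s)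

/-- The deviation from the mean splits into a part depending on `y` only and a part linear in the
sheared deviations of `W`. These are orthogonal, so the variances add. -/
theorem integral_norm_sq_nextModel_le {a μ s v C : ℝ} {q : TrigPoly1} {m : ℤ} {W : C(Torus2, ℂ)}
    {Q : Torus2 → ℝ} (hq : ∀ z, evalVert z q = Q z) (hQ : ∀ z, 0 ≤ Q z ∧ Q z ≤ 1)
    (h1 : IsUncorrelated (driftPoly a μ s q * (modFactor a * q)) m)
    (h2 : IsUncorrelated (driftPoly a μ s q * (modFactor a * (1 - q))) m)
    (h3 : IsUncorrelated q m) (h4 : IsUncorrelated (1 - q) m)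
    (hW : ∫ z, W z ∂torusHaar = μ) (hv : ∫ z, ‖W z - μ‖ ^ 2 ∂torusHaar ≤ v)
    (hC : ∀ z, ‖evalVert z (driftPoly a μ s q)‖ ^ 2 ≤ C) :
    ∫ z, ‖nextModel a q m W z - ((μ - a / 2 * s : ℝ) : ℂ)‖ ^ 2 ∂torusHaar ≤
      C + (1 + a ^ 2) * v := by
  obtain ⟨Y, hY⟩ : ∃ Y : C(Torus2, ℂ), ∀ z, Y z = W z - μ :=
    ⟨W - ContinuousMap.const _ (μ : ℂ), fun z => rfl⟩
  have hY0 : ∫ z, Y z ∂torusHaar = 0 := by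
    simp_rw [hY]
    rw [integral_sub (integrable_of_continuous W.continuous) (integrable_const _), hW]
    simp
  obtain ⟨V, hVY⟩ : ∃ V : C(Torus2, ℂ), ∀ z, V z = ((‖Y z‖ ^ 2 : ℝ) : ℂ) :=
    ⟨⟨fun z => ((‖Y z‖ ^ 2 : ℝ) : ℂ), by fun_prop⟩, fun z => rfl⟩
  have hV : ∫ z, V z ∂torusHaar = ((∫ z, ‖W z - μ‖ ^ 2 ∂torusHaar : ℝ) : ℂ) := by
    rw [← integral_complex_ofReal]
    simp_rw [hVY, hY]
  have hQc : Continuous Q := by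
    have : Q = fun z => (evalVert z q).re := by ext z; rw [hq, Complex.ofReal_re]
    rw [this]
    exact Complex.continuous_re.comp (continuous_evalVert q)
  have hcos := continuous_cosSnd
  obtain ⟨X, hXdef, hX⟩ : ∃ X : Torus2 → ℂ, (∀ z, X z = (1 + Complex.I * a * cosSnd z) *
      (Q z * Y (shear 1 m z) + (1 - Q z) * Y (shear (-1) m z))) ∧ Continuous X := by
    refine ⟨fun z => (1 + Complex.I * a * cosSnd z) *
      (Q z * compShear 1 m Y z + (1 - Q z) * compShear (-1) m Y z), fun z => rfl, by fun_prop⟩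
  obtain ⟨D, hDdef, hD⟩ : ∃ D : Torus2 → ℂ, (∀ z, D z = evalVert z (driftPoly a μ s q)) ∧
      Continuous D := ⟨_, fun z => rfl, continuous_evalVert _⟩
  have hDval : ∀ z, D z = -(Complex.I * a / 2 * (1 + 2 * μ)) * cosSnd z -
      (a / 2 : ℂ) * ((2 * Q z - 1) * sinSnd z - s) := by
    intro z
    simp only [hDdef, driftPoly, map_sub, map_smul, map_mul, hq, evalVert_cosPoly, evalVert_sinPoly,
      smul_eq_mul, map_ofNat, map_one, AlgHom.commutes, Algebra.algebraMap_self, RingHom.id_apply]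
  -- Storing the conjugate of the `y`-part makes the cross term the real part of the plain product
  -- `D z * X z`, to which decorrelation from polynomials applies directly.
  have hconj : ∀ z, nextModel a q m W z - ((μ - a / 2 * s : ℝ) : ℂ) =
      (starRingEnd ℂ) (D z) + X z := by
    intro z
    rw [hDval, nextModel_apply, hq, fourier_one_snd, fourier_neg_one_snd]
    simp only [hXdef, hY, map_sub, map_mul, map_neg, map_div₀, Complex.conj_I, Complex.conj_ofReal,
      map_add, map_one, map_ofNat]
    push_cast
    linear_combination (a / 2 * (2 * Q z - 1) * sinSnd z : ℂ) * Complex.I_sq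
  have hexp : ∀ z, ‖nextModel a q m W z - ((μ - a / 2 * s : ℝ) : ℂ)‖ ^ 2 =
      ‖D z‖ ^ 2 + ‖X z‖ ^ 2 + 2 * (D z * X z).re := by
    intro z
    rw [hconj, ← Complex.normSq_eq_norm_sq, Complex.normSq_add, Complex.normSq_conj,
      ← map_mul, Complex.conj_re, Complex.normSq_eq_norm_sq, Complex.normSq_eq_norm_sq]
  have hDX : ∫ z, D z * X z ∂torusHaar = 0 := by
    have e : ∀ z, D z * X z =
        evalVert z (driftPoly a μ s q * (modFactor a * q)) * Y (shear 1 m z) +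
        evalVert z (driftPoly a μ s q * (modFactor a * (1 - q))) * Y (shear (-1) m z) := by
      intro z
      simp only [hDdef, hXdef, map_mul, map_sub, map_one, evalVert_modFactor, hq]
      ring
    simp_rw [e]
    have c1 : Continuous fun z => evalVert z (driftPoly a μ s q * (modFactor a * q)) *
        Y (shear 1 m z) := (continuous_evalVert _).mul (compShear 1 m Y).continuous
    have c2 : Continuous fun z => evalVert z (driftPoly a μ s q * (modFactor a * (1 - q))) *
        Y (shear (-1) m z) := (continuous_evalVert _).mul (compShear (-1) m Y).continuous
    rw [integral_add (integrable_of_continuous c1) (integrable_of_continuous c2), h1, h2, hY0]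
    simp
  have hXle : ∀ z, ‖X z‖ ^ 2 ≤ (1 + a ^ 2) *
      (Q z * ‖Y (shear 1 m z)‖ ^ 2 + (1 - Q z) * ‖Y (shear (-1) m z)‖ ^ 2) := by
    intro z
    rw [hXdef, norm_mul, mul_pow]
    exact mul_le_mul (norm_modFactor_sq_le a z) (norm_convex_sq_le (hQ z).1 (hQ z).2 _ _)
      (by positivity) (by positivity)
  have hQV : ∀ s : ℤ, ∫ z, Q z * ‖Y (shear s m z)‖ ^ 2 ∂torusHaar =
      (∫ z, Q z ∂torusHaar) * ∫ z, ‖W z - μ‖ ^ 2 ∂torusHaar := by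
    intro s
    have := h3 s V
    rw [hV] at this
    simp_rw [hq] at this
    rw [integral_complex_ofReal] at this
    have e : ∀ z, (Q z : ℂ) * V (shear s m z) = ((Q z * ‖Y (shear s m z)‖ ^ 2 : ℝ) : ℂ) := by
      intro z; rw [Complex.ofReal_mul, hVY]
    simp_rw [e] at this
    rw [integral_complex_ofReal] at this
    exact_mod_cast this
  have hQV' : ∀ s : ℤ, ∫ z, (1 - Q z) * ‖Y (shear s m z)‖ ^ 2 ∂torusHaar =
      (∫ z, (1 - Q z) ∂torusHaar) * ∫ z, ‖W z - μ‖ ^ 2 ∂torusHaar := by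
    intro s
    have := h4 s V
    rw [hV] at this
    have eq1 : ∀ z, evalVert z (1 - q) = ((1 - Q z : ℝ) : ℂ) := by
      intro z; rw [map_sub, map_one, hq]; push_cast; rfl
    simp_rw [eq1] at this
    rw [integral_complex_ofReal] at this
    have e : ∀ z, ((1 - Q z : ℝ) : ℂ) * V (shear s m z) =
        (((1 - Q z) * ‖Y (shear s m z)‖ ^ 2 : ℝ) : ℂ) := by
      intro z; rw [Complex.ofReal_mul, hVY]
    simp_rw [e] at this
    rw [integral_complex_ofReal] at this
    exact_mod_cast this
  have hX2 : ∫ z, ‖X z‖ ^ 2 ∂torusHaar ≤ (1 + a ^ 2) * v := by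
    have c1 : Continuous fun z => Q z * ‖Y (shear 1 m z)‖ ^ 2 :=
      hQc.mul ((compShear 1 m Y).continuous.norm.pow 2)
    have c2 : Continuous fun z => (1 - Q z) * ‖Y (shear (-1) m z)‖ ^ 2 :=
      (continuous_const.sub hQc).mul ((compShear (-1) m Y).continuous.norm.pow 2)
    refine (integral_mono (integrable_of_continuous (by fun_prop))
      ((integrable_of_continuous (by exact c1.add c2)).const_mul _) hXle).trans ?_
    rw [integral_const_mul, integral_add (integrable_of_continuous c1)
      (integrable_of_continuous c2), hQV, hQV', ← add_mul,
      ← integral_add (integrable_of_continuous hQc) (integrable_of_continuous (by fun_prop))]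
    simp only [add_sub_cancel, integral_const, probReal_univ, smul_eq_mul, one_mul]
    gcongr
  have hD2 : ∫ z, ‖D z‖ ^ 2 ∂torusHaar ≤ C := by
    refine (integral_mono (integrable_of_continuous (by fun_prop)) (integrable_const C)
      fun z => by simpa only [hDdef] using hC z).trans ?_
    simp
  have hre : ∫ z, (D z * X z).re ∂torusHaar = 0 := by
    have := integral_re (𝕜 := ℂ) (μ := torusHaar) (f := fun z => D z * X z)
      (integrable_of_continuous (hD.mul hX))
    rw [hDX] at this
    simpa using this
  simp_rw [hexp]
  have c3 : Continuous fun z => (D z * X z).re := Complex.continuous_re.comp (hD.mul hX)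
  rw [integral_add (integrable_of_continuous (by fun_prop))
      (integrable_of_continuous (c3.const_mul 2)),
    integral_add (integrable_of_continuous (by fun_prop)) (integrable_of_continuous (by fun_prop)),
    integral_const_mul, hre]
  linarith

theorem norm_driftPoly_sq_le {a μ s K : ℝ} {q : TrigPoly1} {Q : Torus2 → ℝ}
    (hq : ∀ z, evalVert z q = Q z) (hQ : ∀ z, 0 ≤ Q z ∧ Q z ≤ 1) (hs : |s| ≤ 1)
    (hμ : |1 + 2 * μ| ≤ K) (z : Torus2) :
    ‖evalVert z (driftPoly a μ s q)‖ ^ 2 ≤ a ^ 2 / 4 * (K ^ 2 + 4) := by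
  have h : evalVert z (driftPoly a μ s q) =
      ((-(a / 2) * ((2 * Q z - 1) * sinSnd z - s) : ℝ) : ℂ) +
        ((-(a / 2) * (1 + 2 * μ) * cosSnd z : ℝ) : ℂ) * Complex.I := by
    simp only [driftPoly, map_sub, map_smul, map_mul, hq, evalVert_cosPoly, evalVert_sinPoly,
      smul_eq_mul, map_ofNat, map_one, AlgHom.commutes, Algebra.algebraMap_self, RingHom.id_apply]
    push_cast
    ring
  rw [h, ← Complex.normSq_eq_norm_sq, Complex.normSq_add_mul_I]
  have hσ : |(2 * Q z - 1) * sinSnd z - s| ≤ 2 := by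
    refine (abs_sub _ _).trans ?_
    have h1 : |2 * Q z - 1| ≤ 1 := abs_le.mpr ⟨by linarith [(hQ z).1], by linarith [(hQ z).2]⟩
    have h2 : |sinSnd z| ≤ 1 := abs_le.mpr (sinSnd_mem_Icc z)
    rw [abs_mul]
    nlinarith [abs_nonneg (2 * Q z - 1), abs_nonneg (sinSnd z)]
  have h1 := sq_le_sq' (abs_le.mp hσ).1 (abs_le.mp hσ).2
  have h2 := sq_le_sq' (abs_le.mp hμ).1 (abs_le.mp hμ).2
  have h3 : cosSnd z ^ 2 ≤ 1 := by nlinarith [cosSnd_sq_add_sinSnd_sq z, sq_nonneg (sinSnd z)]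
  have h4 : (1 + 2 * μ) ^ 2 * cosSnd z ^ 2 ≤ K ^ 2 * 1 := by gcongr
  have h5 := mul_le_mul_of_nonneg_left (add_le_add h1 h4) (by positivity : 0 ≤ a ^ 2 / 4)
  nlinarith

/-! ### Blocks and their inductive construction. -/

/-- The points at which no left-half partial sum of `F` with threshold in `Θ` is within `η`
of `W`. -/
def badSet (F : TrigPoly) (Θ : Finset ℝ) (W : C(Torus2, ℂ)) (η : ℝ) : Set Torus2 :=
  {z | ∀ t ∈ Θ, η < ‖evalAt z (restrict (leftHalf t) F) - W z‖}

theorem measurableSet_badSet (F : TrigPoly) (Θ : Finset ℝ) (W : C(Torus2, ℂ)) (η : ℝ) :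
    MeasurableSet (badSet F Θ W η) := by
  have : badSet F Θ W η = ⋂ t ∈ Θ, {z | η < ‖evalAt z (restrict (leftHalf t) F) - W z‖} := by
    ext z; simp [badSet]
  rw [this]
  refine Finset.measurableSet_biInter _ fun t _ => (isOpen_lt continuous_const ?_).measurableSet
  exact ((continuous_evalAt _).sub W.continuous).norm

/-- A bounded polynomial `F`, with thresholds `Θ`, whose half-plane partial sums follow a
continuous function `W` of large mean `μ` and comparatively small variance. -/
structure IsBlock (n : ℕ) (a η : ℝ) (F : TrigPoly) (Θ : Finset ℝ) (W : C(Torus2, ℂ))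
    (μ : ℝ) : Prop where
  abs_fst_lt : ∀ p ∈ F.coeff.support, |p.1| < |p.2|
  fst_ne : ∀ t ∈ Θ, ∀ p ∈ F.coeff.support, (p.1 : ℝ) ≠ t * p.2
  abs_lt_one : ∀ t ∈ Θ, |t| < 1
  norm_sq_le : ∀ z, ‖1 + evalAt z F‖ ^ 2 ≤ (1 + a ^ 2) ^ n
  measure_badSet_le : torusHaar (badSet F Θ W η) ≤ ENNReal.ofReal η
  integral_eq : ∫ z, W z ∂torusHaar = μ
  le_mean : -(a * n / 2) ≤ μ
  mean_le : μ ≤ -(a * n / 8)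
  variance_le : ∫ z, ‖W z - μ‖ ^ 2 ∂torusHaar ≤
    n * (1 + a ^ 2) ^ n * (a ^ 2 / 4 * ((1 + a * n) ^ 2 + 4))

/-- A slope in `(-1, 1)` for one shear corresponds for the other shear to a slope outside that
interval. The spectrum lies in the open cone `|p.1| < |p.2|`, so no frequency meets such a line. -/
theorem fst_ne_mul_snd_of_one_le {p : ℤ × ℤ} (hp : |p.1| < |p.2|) {c : ℝ} (hc : 1 ≤ |c|) :
    (p.1 : ℝ) ≠ c * p.2 := by
  intro h
  have h1 : |(p.1 : ℝ)| < |(p.2 : ℝ)| := by exact_mod_cast hp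
  rw [h, abs_mul] at h1
  nlinarith [abs_nonneg (p.2 : ℝ)]

theorem isBlock_zero (a : ℝ) {η : ℝ} (hη : 0 < η) : IsBlock 0 a η 0 {0} 0 0 where
  abs_fst_lt := by simp
  fst_ne := by simp
  abs_lt_one := by simp
  norm_sq_le := by simp
  measure_badSet_le := by
    have h : badSet 0 {0} 0 η = ∅ := by
      ext z
      have h0 : restrict (leftHalf 0) 0 = 0 := restrict_eq_zero (by simp)
      simpa [badSet, h0] using hη.le
    simp [h]
  integral_eq := by simp
  le_mean := by simp
  mean_le := by simp
  variance_le := by simp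

theorem exists_stepPoly {δ e : ℝ} (hδ : 0 < δ) (hδ' : δ ≤ 1 / 8) (he : 0 < e) (he' : e ≤ 1 / 8) :
    ∃ (q : TrigPoly1) (Q : Torus2 → ℝ), Continuous Q ∧ (∀ z, evalVert z q = Q z) ∧
      (∀ z, 0 ≤ Q z ∧ Q z ≤ 1) ∧ (∀ z, δ ≤ sinSnd z → 1 - e ≤ Q z) ∧
      (∀ z, sinSnd z ≤ -δ → Q z ≤ e) ∧
      ∀ z, sinSnd z ^ 2 - 1 / 4 ≤ (2 * Q z - 1) * sinSnd z := by
  obtain ⟨P, hP⟩ := exists_step_polynomial hδ he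
  refine ⟨Polynomial.aeval sinPoly (P.map (algebraMap ℝ ℂ)), fun z => P.eval (sinSnd z), ?_,
    fun z => ?_, fun z => ?_, fun z => ?_, fun z => ?_, fun z => ?_⟩
  · exact P.continuous.comp continuous_sinSnd
  · rw [← Polynomial.aeval_algHom_apply, evalVert_sinPoly, Polynomial.aeval_map_algebraMap]
    exact Polynomial.aeval_algebraMap_apply_eq_algebraMap_eval _ _
  · exact ⟨(hP _ (sinSnd_mem_Icc z)).1, (hP _ (sinSnd_mem_Icc z)).2.1⟩
  · exact (hP _ (sinSnd_mem_Icc z)).2.2.1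
  · exact (hP _ (sinSnd_mem_Icc z)).2.2.2
  · obtain ⟨h0, h1, h2, h3⟩ := hP _ (sinSnd_mem_Icc z)
    obtain ⟨hs1, hs2⟩ := sinSnd_mem_Icc z
    set s := sinSnd z
    set x := P.eval s
    rcases le_total δ s with h | h
    · have := h2 h
      nlinarith
    · rcases le_total s (-δ) with h' | h'
      · have := h3 h'
        nlinarith
      · have hs : |s| ≤ δ := abs_le.mpr ⟨h', h⟩
        have hx : |2 * x - 1| ≤ 1 := abs_le.mpr ⟨by linarith, by linarith⟩
        have h4 : |(2 * x - 1) * s| ≤ 1 / 8 := by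
          rw [abs_mul]
          nlinarith [abs_nonneg s, abs_nonneg (2 * x - 1)]
        have h5 : s ^ 2 ≤ 1 / 8 := by
          rw [← sq_abs]; nlinarith [abs_nonneg s]
        linarith [(abs_le.mp h4).1]

/-- The lower bound is the mean `1 / 2` of `sin²` minus `1 / 4`. Multiplied by `a / 2`, the two
bounds give a drift between `a / 8` and `a / 2` per step, as recorded in `IsBlock`. -/
theorem le_integral_step {Q : Torus2 → ℝ} (hQc : Continuous Q) (hQ : ∀ z, 0 ≤ Q z ∧ Q z ≤ 1)
    (h : ∀ z, sinSnd z ^ 2 - 1 / 4 ≤ (2 * Q z - 1) * sinSnd z) :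
    1 / 4 ≤ ∫ z, (2 * Q z - 1) * sinSnd z ∂torusHaar ∧
      ∫ z, (2 * Q z - 1) * sinSnd z ∂torusHaar ≤ 1 := by
  have hs := continuous_sinSnd
  constructor
  · have h1 := integral_mono (integrable_of_continuous (by fun_prop))
      (integrable_of_continuous (by fun_prop)) h
    rw [integral_sub (integrable_of_continuous (by fun_prop)) (integrable_const _),
      integral_sinSnd_sq] at h1
    simp only [integral_const, probReal_univ, one_smul] at h1
    linarith
  · have h2 : ∀ z, (2 * Q z - 1) * sinSnd z ≤ 1 := by
      intro z
      have h3 := hQ z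
      have h4 := sinSnd_mem_Icc z
      refine (le_abs_self _).trans ?_
      rw [abs_mul]
      exact mul_le_one₀ (abs_le.mpr ⟨by linarith, by linarith⟩) (abs_nonneg _) (abs_le.mpr h4)
    have h1 := integral_mono (integrable_of_continuous (by fun_prop))
      (integrable_const (1 : ℝ)) h2 (μ := torusHaar)
    simpa using h1

/-- The thresholds of `nextPoly`. -/
def nextThresholds (Θ : Finset ℝ) : Finset ℝ :=
  Θ.image (fun t => (t + 1) / 2) ∪ Θ.image (fun t => (t - 1) / 2)

theorem mem_nextThresholds {Θ : Finset ℝ} {t : ℝ} :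
    t ∈ nextThresholds Θ ↔ 2 * t - 1 ∈ Θ ∨ 2 * t + 1 ∈ Θ := by
  simp only [nextThresholds, Finset.mem_union, Finset.mem_image]
  constructor
  · rintro (⟨x, hx, rfl⟩ | ⟨x, hx, rfl⟩)
    · left; convert hx using 1; ring
    · right; convert hx using 1; ring
  · rintro (h | h)
    · exact .inl ⟨_, h, by ring⟩
    · exact .inr ⟨_, h, by ring⟩

/-- Where `sin y > δ`, a slope `t` good for `F` at the point `shear 1 m z` yields the slope `(t + 1)
/ 2`, which is positive because `|t| < 1` and so selects `e^{iy}`. Where `sin y < -δ`, the slope `(t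
- 1) / 2` is negative and the other shear is used. -/
theorem badSet_nextPoly_subset {a e η η' δ : ℝ} {q : TrigPoly1} {m : ℤ} {F : TrigPoly}
    {Θ : Finset ℝ} {W : C(Torus2, ℂ)} {Q : Torus2 → ℝ} (ha : 0 ≤ a)
    (hq : ∀ z, evalVert z q = Q z) (hQ : ∀ z, 0 ≤ Q z ∧ Q z ≤ 1)
    (hQ1 : ∀ z, δ ≤ sinSnd z → 1 - e ≤ Q z) (hQ2 : ∀ z, sinSnd z ≤ -δ → Q z ≤ e)
    (hη : (1 + a) * η' + e * (a + (1 + a) * (2 * (coeffSum F + ‖W‖))) ≤ η)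
    (hΘ : ∀ t ∈ Θ, |t| < 1)
    (h1 : ∀ t ∈ nextThresholds Θ, ∀ j ∈ (modFactor a * q).coeff.support,
      ∀ p ∈ F.coeff.support, ((0, j) + shearFreq 1 m p ∈ leftHalf t ↔ p ∈ leftHalf (2 * t - 1)))
    (h2 : ∀ t ∈ nextThresholds Θ, ∀ j ∈ (modFactor a * (1 - q)).coeff.support,
      ∀ p ∈ F.coeff.support,
        ((0, j) + shearFreq (-1) m p ∈ leftHalf t ↔ p ∈ leftHalf (2 * t + 1))) :
    badSet (nextPoly a q m F) (nextThresholds Θ) (nextModel a q m W) η ⊆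
      {z | |sinSnd z| ≤ δ} ∪ (shear 1 m ⁻¹' badSet F Θ W η' ∪ shear (-1) m ⁻¹' badSet F Θ W η') := by
  intro z hz
  by_contra hcon
  simp only [Set.mem_union, not_or, Set.mem_preimage, Set.mem_ofPred_eq, not_le] at hcon
  obtain ⟨hsin, hp, hn⟩ := hcon
  simp only [badSet, Set.mem_ofPred_eq, not_forall, not_lt] at hp hn
  have hK : ∀ P z', ‖evalAt z' (restrict P F)‖ ≤ coeffSum F + ‖W‖ := fun P z' =>
    (norm_evalAt_restrict_le P F z').trans (le_add_of_nonneg_right (norm_nonneg _))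
  have hKW : ∀ z', ‖W z'‖ ≤ coeffSum F + ‖W‖ := fun z' =>
    (W.norm_coe_le_norm z').trans
      (le_add_of_nonneg_left (Finset.sum_nonneg fun _ _ => norm_nonneg _))
  rcases lt_abs.mp hsin with hs | hs
  · obtain ⟨t, ht, hle⟩ := hp
    have htm : (t + 1) / 2 ∈ nextThresholds Θ :=
      mem_nextThresholds.mpr (.inl (by convert ht using 1; ring))
    have htpos : 0 < (t + 1) / 2 := by linarith [(abs_lt.mp (hΘ t ht)).1]
    refine absurd (hz _ htm) (not_lt.mpr (le_trans ?_ hη))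
    rw [evalAt_restrict_nextPoly htpos.ne' (h1 _ htm) (h2 _ htm), nextModel_apply, hq,
      if_pos htpos, show 2 * ((t + 1) / 2) - 1 = t by ring]
    exact norm_sub_model_le ha (hQ z).1 (hQ z).2 (by linarith [hQ1 z hs.le])
      (norm_fourier_apply _ _) (norm_fourier_apply _ _) (norm_modFactor_le ha z) hle
      (hK _ _) (hKW _)
  · obtain ⟨t, ht, hle⟩ := hn
    have htm : (t - 1) / 2 ∈ nextThresholds Θ :=
      mem_nextThresholds.mpr (.inr (by convert ht using 1; ring))
    have htneg : (t - 1) / 2 < 0 := by linarith [(abs_lt.mp (hΘ t ht)).2]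
    refine absurd (hz _ htm) (not_lt.mpr (le_trans ?_ hη))
    rw [evalAt_restrict_nextPoly htneg.ne (h1 _ htm) (h2 _ htm), nextModel_apply, hq,
      if_neg htneg.le.not_gt, show 2 * ((t - 1) / 2) + 1 = t by ring]
    have := norm_sub_model_le ha (Q := 1 - Q z) (e := e) (sub_nonneg.mpr (hQ z).2)
      (by linarith [(hQ z).1]) (by linarith [hQ2 z (by linarith)])
      (norm_fourier_apply (-1) z.2) (norm_fourier_apply 1 z.2) (norm_modFactor_le ha z) hle
      (hK (leftHalf (2 * ((t - 1) / 2) - 1)) (shear 1 m z)) (hKW (shear 1 m z))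
    push_cast at this
    rw [sub_sub_cancel] at this
    refine le_trans (le_of_eq (congrArg norm ?_)) this
    ring

theorem eventually_isUncorrelated (g : TrigPoly1) : ∀ᶠ m : ℤ in atTop, IsUncorrelated g m :=
  eventually_integral_evalVert_mul g

theorem variance_step {a v : ℝ} {n : ℕ} (ha : 0 ≤ a)
    (hv : v ≤ n * (1 + a ^ 2) ^ n * (a ^ 2 / 4 * ((1 + a * n) ^ 2 + 4))) :
    a ^ 2 / 4 * ((1 + a * n) ^ 2 + 4) + (1 + a ^ 2) * v ≤
      ((n + 1 : ℕ) : ℝ) * (1 + a ^ 2) ^ (n + 1) *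
        (a ^ 2 / 4 * ((1 + a * (n + 1 : ℕ)) ^ 2 + 4)) := by
  set D := a ^ 2 / 4 * ((1 + a * n) ^ 2 + 4) with hD
  have hD0 : 0 ≤ D := by positivity
  have hDD : D ≤ a ^ 2 / 4 * ((1 + a * (n + 1 : ℕ)) ^ 2 + 4) := by
    rw [hD]
    gcongr
    simp
  have h1 : 1 ≤ (1 + a ^ 2) ^ (n + 1) := one_le_pow₀ (by nlinarith [sq_nonneg a])
  have h2 : (1 + a ^ 2) * v ≤ (1 + a ^ 2) * (n * (1 + a ^ 2) ^ n * D) := by gcongr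
  calc D + (1 + a ^ 2) * v ≤ (1 + a ^ 2) ^ (n + 1) * D + n * (1 + a ^ 2) ^ (n + 1) * D := by
        have h3 : D ≤ (1 + a ^ 2) ^ (n + 1) * D := le_mul_of_one_le_left hD0 h1
        have h4 : (1 + a ^ 2) * (n * (1 + a ^ 2) ^ n * D) = n * (1 + a ^ 2) ^ (n + 1) * D := by
          ring
        linarith
    _ = ((n + 1 : ℕ) : ℝ) * (1 + a ^ 2) ^ (n + 1) * D := by push_cast; ring
    _ ≤ _ := by gcongr

/-- The order of choices matters: the tolerance for the old block, then the block, then the quality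
`e` of the step function in terms of the size `K` of that block, and the dilation `m` last, once `q`
and the drift are known. -/
theorem exists_isBlock_succ {n : ℕ} {a : ℝ} (ha : 0 ≤ a)
    (ih : ∀ η : ℝ, 0 < η → ∃ F Θ W μ, IsBlock n a η F Θ W μ) {η : ℝ} (hη : 0 < η) :
    ∃ F Θ W μ, IsBlock (n + 1) a η F Θ W μ := by
  obtain ⟨η', hη'0, hη'1, hη'2⟩ : ∃ η' : ℝ, 0 < η' ∧ (1 + a) * η' ≤ η / 2 ∧ η' ≤ η / 4 := by
    refine ⟨min (η / 2 / (1 + a)) (η / 4), by positivity, ?_, min_le_right _ _⟩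
    have := min_le_left (η / 2 / (1 + a)) (η / 4)
    rwa [le_div_iff₀ (by positivity), mul_comm] at this
  obtain ⟨F, Θ, W, μ, hB⟩ := ih η' hη'0
  have hK0 : 0 ≤ coeffSum F + ‖W‖ :=
    add_nonneg (Finset.sum_nonneg fun _ _ => norm_nonneg _) (norm_nonneg _)
  set K := coeffSum F + ‖W‖ with hK
  obtain ⟨e, he0, he1, he2⟩ : ∃ e : ℝ, 0 < e ∧ e ≤ 1 / 8 ∧ e * (a + (1 + a) * (2 * K)) ≤ η / 2 := by
    have hL : 0 < a + (1 + a) * (2 * K) + 1 := by positivity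
    refine ⟨min (1 / 8) (η / 2 / (a + (1 + a) * (2 * K) + 1)), by positivity, min_le_left _ _, ?_⟩
    have h1 := min_le_right (1 / 8) (η / 2 / (a + (1 + a) * (2 * K) + 1))
    rw [le_div_iff₀ hL] at h1
    have h2 : 0 ≤ min (1 / 8) (η / 2 / (a + (1 + a) * (2 * K) + 1)) := by positivity
    linarith
  obtain ⟨δ, hδ0, hδ1, hδ⟩ := exists_sinSnd_small (ε := ENNReal.ofReal (η / 2)) (by simpa using hη)
  obtain ⟨q, Q, hQc, hq, hQ, hQ1, hQ2, hQs⟩ := exists_stepPoly hδ0 hδ1 he0 he1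
  obtain ⟨hs1, hs2⟩ := le_integral_step hQc hQ hQs
  set s := ∫ z, (2 * Q z - 1) * sinSnd z ∂torusHaar with hs
  have hne1 : ∀ t ∈ nextThresholds Θ, ∀ p ∈ F.coeff.support,
      (p.1 : ℝ) ≠ (2 * t - (1 : ℤ)) * p.2 := by
    intro t ht p hp
    rcases mem_nextThresholds.mp ht with h | h
    · simpa using hB.fst_ne _ h p hp
    · refine fst_ne_mul_snd_of_one_le (hB.abs_fst_lt p hp) (le_abs.mpr (.inr ?_))
      have := (abs_lt.mp (hB.abs_lt_one _ h)).2
      push_cast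
      linarith
  have hne2 : ∀ t ∈ nextThresholds Θ, ∀ p ∈ F.coeff.support,
      (p.1 : ℝ) ≠ (2 * t - (-1 : ℤ)) * p.2 := by
    intro t ht p hp
    rcases mem_nextThresholds.mp ht with h | h
    · refine fst_ne_mul_snd_of_one_le (hB.abs_fst_lt p hp) (le_abs.mpr (.inl ?_))
      have := (abs_lt.mp (hB.abs_lt_one _ h)).1
      push_cast
      linarith
    · simpa using hB.fst_ne _ h p hp
  have hev1 := (eventually_all_finset (nextThresholds Θ)).mpr fun t ht =>
    eventually_shear_mem_leftHalf (modFactor a * q) 1 (hne1 t ht)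
  have hev2 := (eventually_all_finset (nextThresholds Θ)).mpr fun t ht =>
    eventually_shear_mem_leftHalf (modFactor a * (1 - q)) (-1) (hne2 t ht)
  obtain ⟨m, h1, h2, h3, h4, u1, u2, u3, u4, u5, u6, hm0⟩ := (hev1.and <| hev2.and <|
    (eventually_shear_abs_lt (modFactor a * q) (s := 1) (by norm_num) hB.abs_fst_lt).and <|
    (eventually_shear_abs_lt (modFactor a * (1 - q)) (s := -1) (by norm_num) hB.abs_fst_lt).and <|
    (eventually_isUncorrelated (modFactor a * q)).and <|
    (eventually_isUncorrelated (modFactor a * (1 - q))).and <|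
    (eventually_isUncorrelated (driftPoly a μ s q * (modFactor a * q))).and <|
    (eventually_isUncorrelated (driftPoly a μ s q * (modFactor a * (1 - q)))).and <|
    (eventually_isUncorrelated q).and <| (eventually_isUncorrelated (1 - q)).and <|
    eventually_gt_atTop 0).exists
  have ht0 : ∀ t ∈ nextThresholds Θ, t ≠ 0 ∧ |t| < 1 := by
    intro t ht
    rcases mem_nextThresholds.mp ht with h | h
    · have := abs_lt.mp (hB.abs_lt_one _ h)
      exact ⟨(by linarith [this.1] : 0 < t).ne', abs_lt.mpr ⟨by linarith, by linarith⟩⟩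
    · have := abs_lt.mp (hB.abs_lt_one _ h)
      exact ⟨(by linarith [this.2] : t < 0).ne, abs_lt.mpr ⟨by linarith, by linarith⟩⟩
  have hμ : |1 + 2 * μ| ≤ 1 + a * n := by
    have h5 := hB.le_mean
    have h6 := hB.mean_le
    have h7 : 0 ≤ a * n := by positivity
    exact abs_le.mpr ⟨by linarith, by linarith⟩
  refine ⟨nextPoly a q m F, nextThresholds Θ, nextModel a q m W, μ - a / 2 * s,
    ?_, ?_, fun t ht => (ht0 t ht).2, ?_, ?_, integral_nextModel hq u1 u2 hB.integral_eq,
    ?_, ?_, ?_⟩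
  · intro p hp
    rcases mem_support_nextPoly hp with rfl | rfl | ⟨j, hj, x, hx, rfl⟩ | ⟨j, hj, x, hx, rfl⟩
    · simp
    · simp
    · exact h3 j hj x hx
    · exact h4 j hj x hx
  · intro t ht p hp
    rcases mem_support_nextPoly hp with rfl | rfl | ⟨j, hj, x, hx, rfl⟩ | ⟨j, hj, x, hx, rfl⟩
    · simpa using (ht0 t ht).1.symm
    · simpa using (ht0 t ht).1
    · exact (h1 t ht j hj x hx).2
    · exact (h2 t ht j hj x hx).2
  · intro z
    rw [pow_succ' (1 + a ^ 2) n]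
    exact norm_one_add_nextPoly_sq_le hq hQ hB.norm_sq_le z
  · refine (measure_mono (badSet_nextPoly_subset (η' := η') ha hq hQ hQ1 hQ2 (by linarith)
      hB.abs_lt_one
      (fun t ht j hj p hp => by simpa using (h1 t ht j hj p hp).1)
      (fun t ht j hj p hp => by simpa using (h2 t ht j hj p hp).1))).trans ?_
    have hmp : ∀ s : ℤ, torusHaar (shear s m ⁻¹' badSet F Θ W η') ≤ ENNReal.ofReal (η / 4) := by
      intro s
      rw [(measurePreserving_shear s hm0.ne').measure_preimage
        (measurableSet_badSet _ _ _ _).nullMeasurableSet]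
      exact hB.measure_badSet_le.trans (ENNReal.ofReal_le_ofReal hη'2)
    refine (measure_union_le _ _).trans ((add_le_add hδ ((measure_union_le _ _).trans
      (add_le_add (hmp 1) (hmp (-1))))).trans ?_)
    rw [← ENNReal.ofReal_add (by positivity) (by positivity),
      ← ENNReal.ofReal_add (by positivity) (by positivity)]
    exact ENNReal.ofReal_le_ofReal (by linarith)
  · have := hB.le_mean
    push_cast
    nlinarith
  · have := hB.mean_le
    push_cast
    nlinarith
  · exact (integral_norm_sq_nextModel_le hq hQ u3 u4 u5 u6 hB.integral_eq le_rfl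
      (norm_driftPoly_sq_le hq hQ (abs_le.mpr ⟨by linarith, hs2⟩) hμ)).trans
      (variance_step ha hB.variance_le)

theorem exists_isBlock (n : ℕ) {a : ℝ} (ha : 0 ≤ a) {η : ℝ} (hη : 0 < η) :
    ∃ F Θ W μ, IsBlock n a η F Θ W μ := by
  induction n generalizing η with
  | zero => exact ⟨0, {0}, 0, 0, isBlock_zero a hη⟩
  | succ n ih => exact exists_isBlock_succ ha (fun η hη => ih hη) hη

/-! ### Large half-plane sums by Chebyshev's inequality. -/

/-- The mean has modulus at least `L / 8`. Off a Chebyshev set the model stays within `L / 16` of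
it, and off the bad set some partial sum is within `η` of the model. The constant is `1536 = 6 *
16²`. -/
theorem IsBlock.measure_lt_le {n : ℕ} {a η L κ M : ℝ} {F : TrigPoly} {Θ : Finset ℝ}
    {W : C(Torus2, ℂ)} {μ : ℝ} (h : IsBlock n a η F Θ W μ) (hκ : n * a ^ 2 = κ ^ 2)
    (hκ1 : κ ^ 2 ≤ 1) (hL : a * n = L) (hL1 : 1 ≤ L) (hM : M + η ≤ L / 16) :
    torusHaar {z | ∀ t ∈ Θ, ‖evalAt z (restrict (leftHalf t) F)‖ < M} ≤
      ENNReal.ofReal η + ENNReal.ofReal (1536 * κ ^ 2) := by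
  have hvar : ∫ z, ‖W z - μ‖ ^ 2 ∂torusHaar ≤ 6 * κ ^ 2 * L ^ 2 := by
    refine h.variance_le.trans ?_
    -- Since `n * a ^ 2 = κ ^ 2 ≤ 1`, the power is at most `e`.
    have h1 : (1 + a ^ 2) ^ n ≤ 3 := by
      have h2 : (1 + a ^ 2) ^ n ≤ Real.exp (a ^ 2) ^ n := by
        gcongr
        rw [add_comm]
        exact Real.add_one_le_exp _
      rw [← Real.exp_nat_mul, hκ] at h2
      refine h2.trans ((Real.exp_le_exp.mpr hκ1).trans ?_)
      linarith [Real.exp_one_lt_d9]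
    rw [hL]
    have e : n * (1 + a ^ 2) ^ n * (a ^ 2 / 4 * ((1 + L) ^ 2 + 4)) =
        (1 + a ^ 2) ^ n * ((n * a ^ 2) / 4 * ((1 + L) ^ 2 + 4)) := by ring
    rw [e, hκ]
    have h3 : (1 + L) ^ 2 + 4 ≤ 8 * L ^ 2 := by nlinarith
    calc (1 + a ^ 2) ^ n * (κ ^ 2 / 4 * ((1 + L) ^ 2 + 4)) ≤ 3 * (κ ^ 2 / 4 * (8 * L ^ 2)) := by
          gcongr
      _ = 6 * κ ^ 2 * L ^ 2 := by ring
  have hcheb : torusHaar {z | (L / 16) ^ 2 ≤ ‖W z - μ‖ ^ 2} ≤ ENNReal.ofReal (1536 * κ ^ 2) := by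
    have h1 := mul_meas_ge_le_integral_of_nonneg (μ := torusHaar)
      (f := fun z => ‖W z - μ‖ ^ 2) (Eventually.of_forall fun z => by positivity)
      (integrable_of_continuous (by fun_prop)) ((L / 16) ^ 2)
    rw [← ofReal_measureReal]
    refine ENNReal.ofReal_le_ofReal ?_
    have hL2 : 0 < (L / 16) ^ 2 := by positivity
    rw [← mul_le_mul_iff_right₀ hL2]
    refine (h1.trans hvar).trans (le_of_eq ?_)
    ring
  refine (measure_mono ?_).trans ((measure_union_le _ _).trans
    (add_le_add h.measure_badSet_le hcheb))
  intro z hz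
  by_contra hcon
  simp only [Set.mem_union, not_or, badSet, Set.mem_ofPred_eq, not_forall, not_lt, not_le] at hcon
  obtain ⟨⟨t, ht, hle⟩, hlt⟩ := hcon
  have h1 := hz t ht
  have h2 : ‖W z - μ‖ < L / 16 := lt_of_pow_lt_pow_left₀ 2 (by positivity) hlt
  have h3 : L / 8 ≤ ‖(μ : ℂ)‖ := by
    rw [Complex.norm_real, Real.norm_eq_abs]
    refine le_trans ?_ (neg_le_abs μ)
    have := h.mean_le
    rw [hL] at this
    linarith
  have h4 : ‖(μ : ℂ)‖ ≤ ‖evalAt z (restrict (leftHalf t) F)‖ +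
      ‖evalAt z (restrict (leftHalf t) F) - W z‖ + ‖W z - μ‖ := by
    have e : (μ : ℂ) = evalAt z (restrict (leftHalf t) F) -
        (evalAt z (restrict (leftHalf t) F) - W z) - (W z - μ) := by ring
    conv_lhs => rw [e]
    exact (norm_sub_le _ _).trans (add_le_add_left (norm_sub_le _ _) _)
  linarith

theorem exists_bounded_large_halfPlane_sums {ε : ℝ} (hε : 0 < ε) (M : ℝ) :
    ∃ (F : TrigPoly) (Θ : Finset ℝ), (∀ t ∈ Θ, ∀ p ∈ F.coeff.support, (p.1 : ℝ) ≠ t * p.2) ∧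
      (∀ t ∈ Θ, |t| < 1) ∧ (∀ z, ‖evalAt z F‖ ≤ 3) ∧
      torusHaar {z | ∀ t ∈ Θ, ‖evalAt z (restrict (leftHalf t) F)‖ < M} ≤ ENNReal.ofReal ε := by
  -- With `3072 = 2 * 1536` and `κ ^ 2 ≤ κ`, the Chebyshev term is at most `ε / 2`.
  obtain ⟨κ, hκ0, hκ1, hκε⟩ : ∃ κ : ℝ, 0 < κ ∧ κ ≤ 1 ∧ κ ≤ ε / 3072 :=
    ⟨min 1 (ε / 3072), by positivity, min_le_left _ _, min_le_right _ _⟩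
  obtain ⟨N, hN⟩ := exists_nat_ge (max 1 (16 * (M + 1)) / κ)
  rw [div_le_iff₀ hκ0] at hN
  have hL1 : 1 ≤ N * κ := (le_max_left _ _).trans hN
  have hLM : 16 * (M + 1) ≤ N * κ := (le_max_right _ _).trans hN
  have hN0 : (N : ℝ) ≠ 0 := by rintro h; rw [h] at hL1; norm_num at hL1
  have hη : 0 < min 1 (ε / 2) := by positivity
  have hκ2 : κ ^ 2 ≤ κ := by nlinarith
  have hna : ((N ^ 2 : ℕ) : ℝ) * (κ / N) ^ 2 = κ ^ 2 := by push_cast; field_simp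
  -- With `N ^ 2` steps of size `κ / N` the squared steps add up to `κ ^ 2`, while the drift is of
  -- order `N * κ`, which is unbounded in `N`.
  obtain ⟨F, Θ, W, μ, hB⟩ := exists_isBlock (N ^ 2) (a := κ / N) (by positivity) hη
  have hm := hB.measure_lt_le (L := N * κ) (M := M) hna (by linarith)
    (by push_cast; field_simp) hL1 (by have := min_le_left 1 (ε / 2); linarith)
  refine ⟨F, Θ, hB.fst_ne, hB.abs_lt_one, fun z => ?_, hm.trans ?_⟩
  · have h1 : ‖1 + evalAt z F‖ ^ 2 ≤ 4 := by
      refine (hB.norm_sq_le z).trans ?_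
      have h2 : (1 + (κ / N) ^ 2) ^ (N ^ 2) ≤ Real.exp ((κ / N) ^ 2) ^ (N ^ 2) := by
        gcongr
        rw [add_comm]
        exact Real.add_one_le_exp _
      rw [← Real.exp_nat_mul, hna] at h2
      refine h2.trans ((Real.exp_le_exp.mpr (by linarith : κ ^ 2 ≤ 1)).trans ?_)
      linarith [Real.exp_one_lt_d9]
    have h3 : ‖1 + evalAt z F‖ ≤ 2 := by nlinarith [norm_nonneg (1 + evalAt z F)]
    have h4 := norm_sub_le (1 + evalAt z F) 1
    rw [add_sub_cancel_left, norm_one] at h4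
    linarith
  · rw [← ENNReal.ofReal_add hη.le (by positivity)]
    have := min_le_right 1 (ε / 2)
    exact ENNReal.ofReal_le_ofReal (by linarith)

/-! ### From half-planes to large balls. -/

/-- The endomorphism `(x, y) ↦ (x, N y)` of the torus. -/
def scaleSnd (N : ℤ) : Torus2 →+ Torus2 where
  toFun z := (z.1, N • z.2)
  map_zero' := by simp
  map_add' a b := by ext <;> simp

theorem scaleSnd_apply (N : ℤ) (z : Torus2) : scaleSnd N z = (z.1, N • z.2) := rfl

theorem measurePreserving_scaleSnd {N : ℤ} (hN : N ≠ 0) :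
    MeasurePreserving (scaleSnd N) torusHaar torusHaar := by
  refine measurePreserving_of_surjective ?_ ?_
  · change Continuous fun z : Torus2 => (z.1, N • z.2)
    fun_prop
  · rintro ⟨u, v⟩
    obtain ⟨y, hy⟩ := exists_zsmul_eq hN v
    exact ⟨(u, y), by rw [scaleSnd_apply, hy]⟩

theorem character_scaleSnd (N a b : ℤ) (z : Torus2) :
    character a b (scaleSnd N z) = character a (N * b) z := by
  simp only [character, scaleSnd_apply, fourier_apply, smul_smul, mul_comm]

/-- The action of `scaleSnd` on frequencies. -/
def scaleFreq (N : ℤ) : ℤ × ℤ →+ ℤ × ℤ where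
  toFun p := (p.1, N * p.2)
  map_zero' := by simp
  map_add' p q := by ext <;> simp; ring

@[simp] theorem scaleFreq_apply (N : ℤ) (p : ℤ × ℤ) : scaleFreq N p = (p.1, N * p.2) := rfl

/-- The polynomial `e^{ilx} F(x, N y)`. -/
def modulate (l N : ℤ) (F : TrigPoly) : TrigPoly :=
  AddMonoidAlgebra.single (l, 0) 1 * AddMonoidAlgebra.mapDomainAlgHom ℂ ℂ (scaleFreq N) F

theorem evalAt_modulate (l N : ℤ) (F : TrigPoly) (z : Torus2) :
    evalAt z (modulate l N F) = character l 0 z * evalAt (scaleSnd N z) F := by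
  have : (evalAt z).comp (AddMonoidAlgebra.mapDomainAlgHom ℂ ℂ (scaleFreq N)) =
      evalAt (scaleSnd N z) := by
    refine AddMonoidAlgebra.algHom_ext' ?_ ?_
    · ext p
      simp [character_scaleSnd]
    · ext
  rw [modulate, map_mul, evalAt_single, one_mul, ← this]
  rfl

theorem modulate_add (l N : ℤ) (F G : TrigPoly) :
    modulate l N (F + G) = modulate l N F + modulate l N G := by
  rw [modulate, map_add, mul_add]; rfl

theorem mem_support_modulate {l N : ℤ} {F : TrigPoly} {x : ℤ × ℤ}
    (hx : x ∈ (modulate l N F).coeff.support) :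
    ∃ p ∈ F.coeff.support, x = (l + p.1, N * p.2) := by
  classical
  have h := AddMonoidAlgebra.support_coeff_mul_subset _ _ hx
  obtain ⟨a, ha, b, hb, rfl⟩ := Finset.mem_add.mp h
  rw [AddMonoidAlgebra.coeff_single] at ha
  obtain rfl := Finset.mem_singleton.mp (Finsupp.support_single_subset ha)
  obtain ⟨p, hp, rfl⟩ := Finset.mem_image.mp (Finsupp.mapDomain_support hb)
  exact ⟨p, hp, by simp⟩

theorem restrict_modulate {l N : ℤ} {F : TrigPoly} {P P' : Set (ℤ × ℤ)}
    (h : ∀ p ∈ F.coeff.support, (l + p.1, N * p.2) ∈ P ↔ p ∈ P') :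
    restrict P (modulate l N F) = modulate l N (restrict P' F) := by
  conv_lhs => rw [← restrict_add_restrict_compl P' F, modulate_add, restrict_add]
  rw [restrict_eq_self (F := modulate l N (restrict P' F)),
    restrict_eq_zero (F := modulate l N (restrict P'ᶜ F)), add_zero]
  · intro x hx
    obtain ⟨p, hp, rfl⟩ := mem_support_modulate hx
    obtain ⟨hp, hp'⟩ := mem_support_restrict.mp hp
    rwa [h p hp]
  · intro x hx
    obtain ⟨p, hp, rfl⟩ := mem_support_modulate hx
    obtain ⟨hp, hp'⟩ := mem_support_restrict.mp hp
    rwa [h p hp]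

/-- The centre of a large ball approximating a half-plane near `(l, 0)`. -/
def bigCenter (l u : ℝ) : Plane := !₂[0, l * u]

/-- The radius of a large ball approximating a half-plane near `(l, 0)`. -/
def bigRadius (l u : ℝ) : ℝ := √(l ^ 2 * (1 + u ^ 2))

theorem le_bigRadius (l u : ℝ) : l ≤ bigRadius l u := by
  refine Real.le_sqrt_of_sq_le ?_
  nlinarith [mul_nonneg (sq_nonneg l) (sq_nonneg u)]

theorem norm_bigCenter {l : ℝ} (hl : 0 ≤ l) (u : ℝ) : ‖bigCenter l u‖ = l * |u| := by
  rw [bigCenter, EuclideanSpace.norm_eq, Fin.sum_univ_two]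
  simp [Real.sqrt_sq_eq_abs, abs_mul, abs_of_nonneg hl]

/-- The circle passes through `(l, 0)`. The linear form `a - u * b` defines its tangent there, and
the right-hand side is the curvature correction, negligible for bounded `a`, `b` as `l` grows. -/
theorem mem_ball_bigCenter {l u a b : ℝ} :
    (!₂[l + a, b] : Plane) ∈ Metric.ball (bigCenter l u) (bigRadius l u) ↔
      l * (a - u * b) < -(a ^ 2 + b ^ 2) / 2 := by
  rw [Metric.mem_ball, EuclideanSpace.dist_eq, bigRadius, Fin.sum_univ_two,
    Real.sqrt_lt_sqrt_iff (by positivity)]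
  simp only [bigCenter, Real.dist_eq, sq_abs, PiLp.toLp_apply, Matrix.cons_val_zero,
    Matrix.cons_val_one, Matrix.cons_val_fin_one]
  constructor <;> intro h <;> nlinarith

theorem abs_le_norm_plane (a b : ℝ) : |a| ≤ ‖(!₂[a, b] : Plane)‖ := by
  simpa using PiLp.norm_apply_le (!₂[a, b] : Plane) 0

theorem measurableSet_forall_norm_lt (F : TrigPoly) (Θ : Finset ℝ) (M : ℝ) :
    MeasurableSet {z | ∀ t ∈ Θ, ‖evalAt z (restrict (leftHalf t) F)‖ < M} := by
  have : {z | ∀ t ∈ Θ, ‖evalAt z (restrict (leftHalf t) F)‖ < M} =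
      ⋂ t ∈ Θ, {z | ‖evalAt z (restrict (leftHalf t) F)‖ < M} := by
    ext z; simp
  rw [this]
  exact Finset.measurableSet_biInter _ fun t _ => (isOpen_lt
    (continuous_evalAt _).norm continuous_const).measurableSet

theorem exists_bounded_large_ball_sums {ε : ℝ} (hε : 0 < ε) (hε1 : ε < 1) (M R : ℝ) :
    ∃ (F : TrigPoly) (J : Finset (Plane × ℝ)) (R' : ℝ), J.Nonempty ∧ R + 1 ≤ R' ∧
      (∀ z, ‖evalAt z F‖ ≤ 3) ∧
      (∀ p ∈ F.coeff.support, R ≤ ‖(!₂[(p.1 : ℝ), (p.2 : ℝ)] : Plane)‖ ∧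
        ‖(!₂[(p.1 : ℝ), (p.2 : ℝ)] : Plane)‖ < R') ∧
      (∀ b ∈ J, 0 < b.2 ∧ eccentricity b.1 b.2 ≤ ε ∧ Metric.ball 0 R ⊆ Metric.ball b.1 b.2 ∧
        Metric.ball b.1 b.2 ⊆ Metric.ball 0 R') ∧
      torusHaar {z | ∀ b ∈ J,
        ‖evalAt z (restrict (latticePoints (Metric.ball b.1 b.2)) F)‖ < M} ≤
          ENNReal.ofReal ε := by
  obtain ⟨F, Θ, hne, hΘ, hF, hm⟩ := exists_bounded_large_halfPlane_sums hε M
  -- Stretching the second frequency by `N` turns a slope `t` into `t / N`, so the centre is at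
  -- distance at most `l / N` from the origin: `1 / ε` controls the eccentricity, and 2 keeps the
  -- centre within `l / 2`.
  obtain ⟨N, hN⟩ := exists_nat_ge (max 2 (1 / ε))
  have hN2 : (2 : ℝ) ≤ N := (le_max_left _ _).trans hN
  have hNε : 1 / (N : ℝ) ≤ ε := by
    rw [one_div_le (by linarith) hε]
    exact (le_max_right _ _).trans hN
  have hN0 : (N : ℝ) ≠ 0 := by linarith
  have hNZ : (N : ℤ) ≠ 0 := by exact_mod_cast hN0
  have hev := (eventually_all_finset Θ).mpr fun t ht =>
    (eventually_all_finset F.coeff.support).mpr fun p hp =>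
      eventually_mul_lt_iff (sub_ne_zero.mpr (hne t ht p hp))
        (-((p.1 : ℝ) ^ 2 + ((N : ℝ) * p.2) ^ 2) / 2)
  have hev2 : ∀ᶠ l : ℤ in atTop, ∀ p ∈ F.coeff.support, R + |(p.1 : ℝ)| ≤ l := by
    rw [eventually_all_finset]
    exact fun p _ => tendsto_intCast_atTop_atTop.eventually_ge_atTop _
  -- The conditions on `l` make each ball agree with its half-plane on the spectrum, push the
  -- spectrum outside radius `R`, and make each ball contain the ball of radius `R` about the
  -- origin.
  obtain ⟨l, hl1, hl2, hl3, hl0⟩ := (hev.and <| hev2.and <|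
    (tendsto_intCast_atTop_atTop.eventually_ge_atTop (2 * R)).and <|
    eventually_gt_atTop 0).exists
  have hl0' : (0 : ℝ) < l := by exact_mod_cast hl0
  have hu : ∀ t ∈ Θ, |t / N| ≤ 1 / N := by
    intro t ht
    rw [abs_div, abs_of_nonneg (by linarith : (0 : ℝ) ≤ N)]
    gcongr
    exact (hΘ t ht).le
  have hN12 : 1 / (N : ℝ) ≤ 1 / 2 := by gcongr
  obtain ⟨J, hJ⟩ : ∃ J : Finset (Plane × ℝ),
      ∀ b, b ∈ J ↔ ∃ t ∈ Θ, (bigCenter l (t / N), bigRadius l (t / N)) = b := by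
    classical exact ⟨Θ.image _, fun b => Finset.mem_image⟩
  have hJ' : ∀ p : Plane → ℝ → Prop, (∀ b ∈ J, p b.1 b.2) ↔
      ∀ t ∈ Θ, p (bigCenter l (t / N)) (bigRadius l (t / N)) := by
    refine fun p => ⟨fun h t ht => h _ ((hJ _).mpr ⟨t, ht, rfl⟩), fun h b hb => ?_⟩
    obtain ⟨t, ht, rfl⟩ := (hJ b).mp hb
    exact h t ht
  have hrestr : ∀ t ∈ Θ,
      restrict (latticePoints (Metric.ball (bigCenter l (t / N)) (bigRadius l (t / N))))
        (modulate l N F) = modulate l N (restrict (leftHalf t) F) := by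
    intro t ht
    refine restrict_modulate fun p hp => ?_
    have h1 := (hl1 t ht p hp).1
    rw [mem_leftHalf, ← sub_neg, ← h1, latticePoints, Set.mem_ofPred_eq]
    push_cast
    rw [mem_ball_bigCenter, ← mul_assoc, div_mul_cancel₀ _ hN0]
  have hm' : torusHaar {z | ∀ b ∈ J,
      ‖evalAt z (restrict (latticePoints (Metric.ball b.1 b.2)) (modulate l N F))‖ < M} ≤
        ENNReal.ofReal ε := by
    have hset : {z | ∀ b ∈ J,
        ‖evalAt z (restrict (latticePoints (Metric.ball b.1 b.2)) (modulate l N F))‖ < M} =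
        scaleSnd N ⁻¹' {z | ∀ t ∈ Θ, ‖evalAt z (restrict (leftHalf t) F)‖ < M} := by
      ext z
      have key : ∀ t ∈ Θ, ‖evalAt z (restrict (latticePoints
          (Metric.ball (bigCenter l (t / N)) (bigRadius l (t / N)))) (modulate l N F))‖ =
          ‖evalAt (scaleSnd N z) (restrict (leftHalf t) F)‖ := by
        intro t ht
        rw [hrestr t ht, evalAt_modulate, norm_mul, norm_character, one_mul]
      exact (hJ' fun c r => ‖evalAt z (restrict (latticePoints (Metric.ball c r))
        (modulate l N F))‖ < M).trans (forall₂_congr fun t ht => by rw [key t ht])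
    rw [hset, (measurePreserving_scaleSnd hNZ).measure_preimage
      (measurableSet_forall_norm_lt F Θ M).nullMeasurableSet]
    exact hm
  -- Over an empty family the exceptional set would be the whole torus, of measure `1 > ε`.
  have hJne : J.Nonempty := by
    rw [Finset.nonempty_iff_ne_empty]
    intro h
    rw [h] at hm'
    have huniv : {z : Torus2 | ∀ b ∈ (∅ : Finset (Plane × ℝ)), ‖evalAt z
        (restrict (latticePoints (Metric.ball b.1 b.2)) (modulate l N F))‖ < M} = Set.univ := by
      ext z; simp
    rw [huniv, measure_univ, ← ENNReal.ofReal_one, ENNReal.ofReal_le_ofReal_iff hε.le] at hm'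
    linarith
  obtain ⟨R', hR'⟩ : ∃ R' : ℝ, R + 1 ≤ R' ∧ (∀ p ∈ (modulate l N F).coeff.support,
      ‖(!₂[(p.1 : ℝ), (p.2 : ℝ)] : Plane)‖ < R') ∧ ∀ b ∈ J, b.2 + ‖b.1‖ ≤ R' := by
    refine ((eventually_ge_atTop (R + 1)).and (Eventually.and ?_ ?_)).exists
    · exact (eventually_all_finset _).mpr fun p _ => eventually_gt_atTop _
    · exact (eventually_all_finset _).mpr fun b _ => eventually_ge_atTop _
  refine ⟨modulate l N F, J, R', hJne, hR'.1, fun z => ?_, fun p hp => ⟨?_, hR'.2.1 p hp⟩,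
    fun b hb => ?_, hm'⟩
  · rw [evalAt_modulate, norm_mul, norm_character, one_mul]
    exact hF _
  · obtain ⟨x, hx, rfl⟩ := mem_support_modulate hp
    refine le_trans ?_ (abs_le_norm_plane _ _)
    push_cast
    have h1 := hl2 x hx
    have h2 := neg_abs_le (x.1 : ℝ)
    exact le_trans (by linarith) (le_abs_self _)
  · have h5 := hR'.2.2 b hb
    obtain ⟨t, ht, rfl⟩ := (hJ b).mp hb
    have h1 := le_bigRadius l (t / N)
    have h2 := norm_bigCenter hl0'.le (t / N)
    have h3 : l * |t / N| ≤ l * (1 / N) := by gcongr; exact hu t ht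
    have h4 : (l : ℝ) * (1 / N) ≤ l * (1 / 2) := by gcongr
    refine ⟨hl0'.trans_le h1, ?_, ?_, ?_⟩
    · rw [eccentricity, h2, div_le_iff₀ (hl0'.trans_le h1)]
      calc l * |t / N| ≤ l * ε := by gcongr; exact (hu t ht).trans hNε
        _ ≤ bigRadius l (t / N) * ε := by gcongr
        _ = _ := mul_comm _ _
    · refine Metric.ball_subset_ball' ?_
      rw [dist_zero_left]
      dsimp only
      linarith
    · refine Metric.ball_subset_ball' ?_
      rw [dist_zero_right]
      exact h5

/-! ### Fourier coefficients and the lacunary series. -/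

/-- A trigonometric polynomial as a continuous function. -/
def toContinuousMap (F : TrigPoly) : C(Torus2, ℂ) := ⟨fun z => evalAt z F, continuous_evalAt F⟩

theorem coeff_evalAt (F : TrigPoly) (n m : ℤ) :
    coeff (fun z => evalAt z F) n m = F.coeff (n, m) := by
  rw [coeff_eq_integral]
  simp_rw [evalAt_eq_sum, Finset.sum_mul]
  rw [integral_finsetSum _ fun p _ => integrable_of_continuous (by
    have := continuous_character p.1 p.2
    have := continuous_character (-n) (-m)
    fun_prop)]
  simp_rw [mul_assoc, integral_const_mul, ← character_add, integral_character]
  rw [Finset.sum_eq_single (n, m)]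
  · simp
  · rintro ⟨a, b⟩ _ hne
    rw [if_neg, mul_zero]
    intro h
    simp only [Prod.mk_eq_zero] at h
    exact hne (Prod.ext (by dsimp only; omega) (by dsimp only; omega))
  · intro h
    rw [Finsupp.notMem_support_iff.mp h, zero_mul]

/-- The Fourier coefficient as a continuous linear functional. -/
def coeffCLM (n m : ℤ) : C(Torus2, ℂ) →L[ℂ] ℂ :=
  LinearMap.mkContinuous
    { toFun := fun f => coeff f n m
      map_add' := fun f g => by
        have := continuous_character (-n) (-m)
        simp only [coeff_eq_integral, ContinuousMap.add_apply, add_mul]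
        exact integral_add (integrable_of_continuous (by fun_prop))
          (integrable_of_continuous (by fun_prop))
      map_smul' := fun c f => by
        simp only [coeff_eq_integral, ContinuousMap.smul_apply, smul_eq_mul, mul_assoc,
          integral_const_mul, RingHom.id_apply] }
    1 (fun f => by
      change ‖coeff f n m‖ ≤ 1 * ‖f‖
      rw [coeff_eq_integral]
      refine (norm_integral_le_of_norm_le_const (Eventually.of_forall fun z => ?_)).trans
        (by rw [probReal_univ, mul_one, one_mul])
      rw [norm_mul, norm_character, mul_one]
      exact f.norm_coe_le_norm z)

theorem coeffCLM_apply (n m : ℤ) (f : C(Torus2, ℂ)) : coeffCLM n m f = coeff f n m := rfl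

theorem partialSum_eq_evalAt_restrict {G : Set Plane} {f : Torus2 → ℂ} {P : TrigPoly}
    (h : ∀ p ∈ latticePoints G, coeff f p.1 p.2 = P.coeff p) (z : Torus2) :
    partialSum G z f = evalAt z (restrict (latticePoints G) P) := by
  classical
  rw [partialSum, evalAt_eq_sum, finsum_mem_congr rfl fun p hp => by rw [h p hp],
    finsum_mem_eq_sum_of_inter_support_eq (t := (restrict (latticePoints G) P).coeff.support)]
  · refine Finset.sum_congr rfl fun p hp => ?_
    rw [coeff_restrict, Finsupp.filter_apply_pos _ _ (mem_support_restrict.mp hp).2]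
  · ext p
    rw [Set.mem_inter_iff, Set.mem_inter_iff, Finset.mem_coe, mem_support_restrict,
      Finsupp.mem_support_iff, Function.mem_support, mul_ne_zero_iff]
    tauto

theorem restrict_smul (S : Set (ℤ × ℤ)) (c : ℂ) (F : TrigPoly) :
    restrict S (c • F) = c • restrict S F := by
  classical
  ext1
  simp [coeff_restrict, Finsupp.filter_smul]

theorem restrict_sum (S : Set (ℤ × ℤ)) {ι : Type*} (s : Finset ι) (F : ι → TrigPoly) :
    restrict S (∑ i ∈ s, F i) = ∑ i ∈ s, restrict S (F i) :=
  map_sum (AddMonoidHom.mk' (restrict S) (restrict_add S)) F s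

/-- Bounded polynomials `P k` with frequencies in the annuli `R k ≤ ‖p‖ < R (k + 1)`, and finite
families `J k` of balls over which their partial sums are large off small sets. -/
structure IsLacunary (P : ℕ → TrigPoly) (J : ℕ → Finset (Plane × ℝ)) (R : ℕ → ℝ) : Prop where
  nonempty : ∀ k, (J k).Nonempty
  add_one_le : ∀ k, R k + 1 ≤ R (k + 1)
  norm_le : ∀ k z, ‖evalAt z (P k)‖ ≤ 3
  le_norm : ∀ k, ∀ p ∈ (P k).coeff.support, R k ≤ ‖(!₂[(p.1 : ℝ), (p.2 : ℝ)] : Plane)‖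
  norm_lt : ∀ k, ∀ p ∈ (P k).coeff.support, ‖(!₂[(p.1 : ℝ), (p.2 : ℝ)] : Plane)‖ < R (k + 1)
  pos : ∀ k, ∀ b ∈ J k, 0 < b.2
  eccentricity_le : ∀ k, ∀ b ∈ J k, eccentricity b.1 b.2 ≤ (1 / 2) ^ (k + 1)
  subset_ball : ∀ k, ∀ b ∈ J k, Metric.ball 0 (R k) ⊆ Metric.ball b.1 b.2
  ball_subset : ∀ k, ∀ b ∈ J k, Metric.ball b.1 b.2 ⊆ Metric.ball 0 (R (k + 1))
  measure_le : ∀ k, torusHaar {z | ∀ b ∈ J k,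
    ‖evalAt z (restrict (latticePoints (Metric.ball b.1 b.2)) (P k))‖ < 2 ^ k * (k + 6)} ≤
      ENNReal.ofReal ((1 / 2) ^ (k + 1))

theorem exists_isLacunary : ∃ P J R, IsLacunary P J R := by
  have h : ∀ (k : ℕ) (R : ℝ), _ := fun k R => exists_bounded_large_ball_sums
    (ε := (1 / 2) ^ (k + 1)) (by positivity)
    (pow_lt_one₀ (by norm_num) (by norm_num) (Nat.succ_ne_zero k)) (2 ^ k * (k + 6)) R
  choose F J R' h1 h2 h3 h4 h5 h6 using h
  let R : ℕ → ℝ := Nat.rec 0 fun k r => R' k r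
  exact ⟨fun k => F k (R k), fun k => J k (R k), R,
    { nonempty := fun k => h1 k (R k)
      add_one_le := fun k => h2 k (R k)
      norm_le := fun k => h3 k (R k)
      le_norm := fun k p hp => (h4 k (R k) p hp).1
      norm_lt := fun k p hp => (h4 k (R k) p hp).2
      pos := fun k b hb => (h5 k (R k) b hb).1
      eccentricity_le := fun k b hb => (h5 k (R k) b hb).2.1
      subset_ball := fun k b hb => (h5 k (R k) b hb).2.2.1
      ball_subset := fun k b hb => (h5 k (R k) b hb).2.2.2
      measure_le := fun k => h6 k (R k) }⟩

namespace IsLacunary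

variable {P : ℕ → TrigPoly} {J : ℕ → Finset (Plane × ℝ)} {R : ℕ → ℝ}

theorem monotone (h : IsLacunary P J R) : Monotone R :=
  monotone_nat_of_le_succ fun k => by linarith [h.add_one_le k]

theorem exists_lt (h : IsLacunary P J R) (x : ℝ) : ∃ k, x < R k := by
  have h1 : ∀ k : ℕ, R 0 + k ≤ R k := by
    intro k
    induction k with
    | zero => simp
    | succ k ih => push_cast; linarith [h.add_one_le k]
  obtain ⟨k, hk⟩ := exists_nat_gt (x - R 0)
  exact ⟨k, by linarith [h1 k]⟩

/-- The continuous function `∑ 2⁻ᵏ P k`. -/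
def limit (P : ℕ → TrigPoly) : C(Torus2, ℂ) :=
  ∑' k, ((1 / 2 : ℂ) ^ k) • toContinuousMap (P k)

theorem summable (h : IsLacunary P J R) :
    Summable fun k => ((1 / 2 : ℂ) ^ k) • toContinuousMap (P k) := by
  refine Summable.of_norm_bounded (g := fun k : ℕ => (1 / 2 : ℝ) ^ k * 3)
    (summable_geometric_two.mul_right 3) fun k => ?_
  rw [norm_smul, norm_pow]
  have h1 : ‖toContinuousMap (P k)‖ ≤ 3 :=
    (ContinuousMap.norm_le _ (by norm_num)).mpr fun z => h.norm_le k z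
  have h2 : ‖(1 / 2 : ℂ)‖ = 1 / 2 := by norm_num
  rw [h2]
  gcongr

/-- Coefficients pass through the uniformly convergent series, and blocks of index above `k` have no
frequencies inside radius `R (k + 1)`. -/
theorem coeff_limit (h : IsLacunary P J R) {k : ℕ} {p : ℤ × ℤ}
    (hp : ‖(!₂[(p.1 : ℝ), (p.2 : ℝ)] : Plane)‖ < R (k + 1)) :
    coeff (limit P) p.1 p.2 =
      (∑ l ∈ Finset.range (k + 1), ((1 / 2 : ℂ) ^ l) • P l).coeff p := by
  have h1 : HasSum (fun l => (1 / 2 : ℂ) ^ l * (P l).coeff p) (coeff (limit P) p.1 p.2) := by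
    have := h.summable.hasSum.mapL (coeffCLM p.1 p.2)
    simp_rw [map_smul, coeffCLM_apply] at this
    have e : ∀ l, coeff (toContinuousMap (P l)) p.1 p.2 = (P l).coeff p := fun l =>
      coeff_evalAt (P l) p.1 p.2
    simp_rw [e] at this
    exact this
  have h2 : HasSum (fun l => (1 / 2 : ℂ) ^ l * (P l).coeff p)
      (∑ l ∈ Finset.range (k + 1), (1 / 2 : ℂ) ^ l * (P l).coeff p) := by
    refine hasSum_sum_of_ne_finset_zero fun l hl => ?_
    rw [Finset.mem_range, not_lt] at hl
    have h3 : p ∉ (P l).coeff.support := fun hmem =>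
      absurd (hp.trans_le (h.monotone hl)) (not_lt.mpr (h.le_norm l p hmem))
    rw [Finsupp.notMem_support_iff.mp h3, mul_zero]
  rw [h1.unique h2, AddMonoidAlgebra.coeff_sum, Finsupp.finsetSum_apply]
  rfl

/-- The ball swallows all earlier blocks and misses all later ones. The earlier ones contribute at
most `3 * 2 = 6`, which the summand 6 in the threshold compensates, and the factor `2 ^ k` undoes
the weight of `P k`. -/
theorem norm_partialSum_limit (h : IsLacunary P J R) {k : ℕ} {b : Plane × ℝ} (hb : b ∈ J k)
    {z : Torus2} (hz : 2 ^ k * (k + 6) ≤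
      ‖evalAt z (restrict (latticePoints (Metric.ball b.1 b.2)) (P k))‖) :
    (k : ℝ) ≤ ‖partialSum (Metric.ball b.1 b.2) z (limit P)‖ := by
  have hcoef : ∀ p ∈ latticePoints (Metric.ball b.1 b.2), coeff (limit P) p.1 p.2 =
      (∑ l ∈ Finset.range (k + 1), ((1 / 2 : ℂ) ^ l) • P l).coeff p := by
    intro p hp
    have := h.ball_subset k b hb hp
    rw [mem_ball_zero_iff] at this
    exact h.coeff_limit this
  rw [partialSum_eq_evalAt_restrict hcoef, restrict_sum, Finset.sum_range_succ, map_add,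
    map_sum]
  have h1 : ‖∑ l ∈ Finset.range k, evalAt z (restrict (latticePoints (Metric.ball b.1 b.2))
      (((1 / 2 : ℂ) ^ l) • P l))‖ ≤ 6 := by
    have h2 : ∀ l ∈ Finset.range k, ‖evalAt z (restrict (latticePoints (Metric.ball b.1 b.2))
        (((1 / 2 : ℂ) ^ l) • P l))‖ ≤ (1 / 2 : ℝ) ^ l * 3 := by
      intro l hl
      rw [restrict_smul, restrict_eq_self, map_smul, norm_smul, norm_pow]
      · have h3 : ‖(1 / 2 : ℂ)‖ = 1 / 2 := by norm_num
        rw [h3]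
        gcongr
        exact h.norm_le l z
      · intro p hp
        refine h.subset_ball k b hb ?_
        rw [mem_ball_zero_iff]
        exact (h.norm_lt l p hp).trans_le (h.monotone (Finset.mem_range.mp hl))
    refine (norm_sum_le_of_le _ h2).trans ?_
    rw [← Finset.sum_mul]
    have h4 := summable_geometric_two.sum_le_tsum (Finset.range k) fun l _ => by positivity
    rw [tsum_geometric_two] at h4
    linarith
  have h5 : (k : ℝ) + 6 ≤ ‖evalAt z (restrict (latticePoints (Metric.ball b.1 b.2))
      (((1 / 2 : ℂ) ^ k) • P k))‖ := by
    have h3 : ‖(1 / 2 : ℂ)‖ = 1 / 2 := by norm_num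
    rw [restrict_smul, map_smul, norm_smul, norm_pow, h3]
    calc (k : ℝ) + 6 = (1 / 2) ^ k * (2 ^ k * (k + 6)) := by
          rw [← mul_assoc, ← mul_pow]; norm_num
      _ ≤ _ := by gcongr
  have h6 := norm_sub_le_norm_add (evalAt z (restrict (latticePoints (Metric.ball b.1 b.2))
      (((1 / 2 : ℂ) ^ k) • P k))) (∑ l ∈ Finset.range k, evalAt z
        (restrict (latticePoints (Metric.ball b.1 b.2)) (((1 / 2 : ℂ) ^ l) • P l)))
  rw [add_comm]
  linarith

/-- Borel–Cantelli: the exceptional sets have summable measures. -/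
theorem ae_eventually_exists_le (h : IsLacunary P J R) :
    ∀ᵐ z : Torus2, ∀ᶠ k in atTop, ∃ b ∈ J k,
      (k : ℝ) ≤ ‖partialSum (Metric.ball b.1 b.2) z (limit P)‖ := by
  rw [volume_eq_smul_torusHaar]
  refine Measure.ae_smul_measure ?_ _
  have hsum : ∑' k, torusHaar {z | ∀ b ∈ J k,
      ‖evalAt z (restrict (latticePoints (Metric.ball b.1 b.2)) (P k))‖ < 2 ^ k * (k + 6)} ≠ ⊤ := by
    refine ne_top_of_le_ne_top ?_ (ENNReal.tsum_le_tsum h.measure_le)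
    rw [← ENNReal.ofReal_tsum_of_nonneg (fun k => by positivity)
      ((summable_nat_add_iff 1).mpr summable_geometric_two)]
    exact ENNReal.ofReal_ne_top
  filter_upwards [ae_eventually_notMem hsum] with z hz
  filter_upwards [hz] with k hk
  simp only [not_forall, not_lt] at hk
  obtain ⟨b, hb, hle⟩ := hk
  exact ⟨b, hb, h.norm_partialSum_limit hb hle⟩

/-- An enumeration of all balls of all the families. -/
theorem exists_enumeration (h : IsLacunary P J R) :
    ∃ (κ : ℕ → ℕ) (b : ℕ → Plane × ℝ), (∀ n, b n ∈ J (κ n)) ∧ Tendsto κ atTop atTop ∧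
      ∀ k, ∀ x ∈ J k, ∃ n, κ n = k ∧ b n = x := by
  let ι := (k : ℕ) × {x // x ∈ J k}
  have hne : ∀ k, Nonempty {x // x ∈ J k} := fun k => (h.nonempty k).to_subtype
  have : Infinite ι :=
    Infinite.of_surjective (Sigma.fst : ι → ℕ) fun k => ⟨⟨k, (hne k).some⟩, rfl⟩
  obtain ⟨e⟩ := nonempty_equiv_of_countable (α := ℕ) (β := ι)
  refine ⟨fun n => (e n).1, fun n => (e n).2.1, fun n => (e n).2.2, ?_, fun k x hx =>
    ⟨e.symm ⟨k, ⟨x, hx⟩⟩, congrArg (fun i : ι => i.1) (e.apply_symm_apply _),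
      congrArg (fun i : ι => i.2.1) (e.apply_symm_apply _)⟩⟩
  -- Each family is finite, so each block index is taken only finitely often.
  rw [← Nat.cofinite_eq_atTop]
  have h1 : Tendsto (Sigma.fst : ι → ℕ) cofinite cofinite := by
    refine Tendsto.cofinite_of_finite_preimage_singleton fun k => ?_
    refine (Set.finite_range fun x : {x // x ∈ J k} => (⟨k, x⟩ : ι)).subset ?_
    rintro ⟨k', b⟩ rfl
    exact ⟨b, rfl⟩
  exact h1.comp e.injective.tendsto_cofinite

end IsLacunary

end DoubleFourier

end


/-! ### Assembly of the function and the sequence of balls. -/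

theorem theorem2 :
    ∃ (f : C(DoubleFourier.Torus2, ℂ)) (c : ℕ → DoubleFourier.Plane) (r : ℕ → ℝ),
      (∀ k, 0 < r k) ∧
      DoubleFourier.IsCompleteSeq (fun k => Metric.ball (c k) (r k)) ∧
      Tendsto (fun k => DoubleFourier.eccentricity (c k) (r k)) atTop (𝓝 0) ∧
      ∀ᵐ z : DoubleFourier.Torus2,
        limsup (fun k => ‖DoubleFourier.partialSum (Metric.ball (c k) (r k)) z f‖ₑ) atTop = ⊤ := by
  obtain ⟨P, J, R, h⟩ := DoubleFourier.exists_isLacunary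
  obtain ⟨κ, b, hb, hκ, hsurj⟩ := h.exists_enumeration
  refine ⟨DoubleFourier.IsLacunary.limit P, fun n => (b n).1, fun n => (b n).2,
    fun n => h.pos _ _ (hb n), ?_, ?_, ?_⟩
  · refine Set.eq_univ_of_forall fun p => ?_
    obtain ⟨k, hk⟩ := h.exists_lt ‖p‖
    obtain ⟨x, hx⟩ := h.nonempty k
    obtain ⟨n, rfl, rfl⟩ := hsurj k x hx
    exact Set.mem_iUnion.mpr ⟨n, h.subset_ball _ _ hx (mem_ball_zero_iff.mpr hk)⟩
  · have h1 : Tendsto (fun n => (1 / 2 : ℝ) ^ (κ n + 1)) atTop (𝓝 0) :=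
      ((tendsto_pow_atTop_nhds_zero_of_lt_one (by norm_num) (by norm_num)).comp
        (tendsto_add_atTop_nat 1)).comp hκ
    exact squeeze_zero (fun n => div_nonneg (norm_nonneg _) (h.pos _ _ (hb n)).le)
      (fun n => h.eccentricity_le _ _ (hb n)) h1
  · filter_upwards [h.ae_eventually_exists_le] with z hz
    refine ENNReal.eq_top_of_forall_nnreal_le fun x => le_limsup_of_frequently_le ?_
    rw [frequently_atTop]
    intro n₀
    -- A block index exceeding all those used before `n₀` forces the ball chosen from that block to
    -- occur at a position `n ≥ n₀`.
    have h1 : ∀ᶠ k in atTop, ∀ i ∈ Finset.range n₀, κ i < k :=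
      (eventually_all_finset _).mpr fun i _ => eventually_gt_atTop _
    obtain ⟨k, ⟨y, hy, hky⟩, hk, hx⟩ := (hz.and (h1.and (eventually_ge_atTop ⌈x⌉₊))).exists
    obtain ⟨n, rfl, rfl⟩ := hsurj k y hy
    refine ⟨n, ?_, ?_⟩
    · by_contra hlt
      exact lt_irrefl _ (hk n (Finset.mem_range.mpr (not_le.mp hlt)))
    · have h2 : (x : ℝ) ≤ ‖DoubleFourier.partialSum (Metric.ball (b n).1 (b n).2) z
          (DoubleFourier.IsLacunary.limit P)‖ := by
        have h3 : (x : ℝ) ≤ (κ n : ℝ) := by exact_mod_cast Nat.ceil_le.mp hx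
        exact h3.trans hky
      rw [← ofReal_norm, ← ENNReal.ofReal_coe_nnreal]
      exact ENNReal.ofReal_le_ofReal h2
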